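/- Let $\mathcal X$ be a finite set, $K$ an irreducible Markov kernel on $\mathcal X$ (that is, $K(x,y)\ge 0$ and $\sum_y K(x,y)=1$) with invariant probability distribution $\varpi$, reversible in the sense that $K(x,y)\varpi(x)=K(y,x)\varpi(y)$ for all $x,y$. Let $\mathcal M$ be the set of functions $\mu:\mathcal X\to[0,\infty)$, and put $\|\mu\|_{\varpi,1}=\sum_x\varpi(x)|\mu(x)|$. Fix $a,b>0$ and a strictly positive $p:\mathcal X\to(0,\infty)$ with $\|p\|_{\varpi,1}=1$. Let $\theta(u,v)=\int_0^1u^{\xi}v^{1-\xi}\,d\xi$ be the logarithmic mean, $\hat\mu(x,y)=\theta(\mu(x),\mu(y))$, $\nabla\psi(x,y)=\psi(y)-\psi(x)$, $(\nabla\cdot\Psi)(x)=\frac12\sum_y(\Psi(x,y)-\Psi(y,x))K(x,y)$. For $\mu_0,\mu_1\in\mathcal M$ let $$\mathcal W_p^{a,b}(\mu_0,\mu_1)^2=\inf\Big\{a^2\int_0^1h_t^2\,dt+b^2\int_0^1\frac12\sum_{x,y}(\nabla\psi_t(x,y))^2\hat\mu_t(x,y)K(x,y)\varpi(x)\,dt\Big\},$$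 the infimum being over absolutely continuous $\mu:[0,1]\to\mathcal M$ with $\mu_t|_{t=0}=\mu_0$ and $\mu_t|_{t=1}=\mu_1$, and measurable $\psi:[0,1]\to\mathbb R^{\mathcal X}$, $h:[0,1]\to\mathbb R$, such that $\dot\mu_t+\nabla\cdot(\hat\mu_t\nabla\psi_t)=h_t\,p$ for a.e. $t\in[0,1]$. Let $$D_p^{a,b}(\mu_0,\mu_1)=\inf\Big(a^2(|H_0|+|H_1|)^2+b^2\int_0^1\frac12\sum_{x,y}\frac{U_t(x,y)^2}{\hat\nu_t(x,y)}K(x,y)\varpi(x)\,dt\Big)^{1/2},$$ the infimum being over $H_0,H_1\in\mathbb R$ with $\mu_0+H_0p,\ \mu_1+H_1p\in\mathcal M$ and $\|\mu_0\|_{\varpi,1}+H_0=\|\mu_1\|_{\varpi,1}+H_1$, over $C^1$ curves $\nu:[0,1]\to\mathcal M$ with $\nu_t|_{t=0}=\mu_0+H_0p$ and $\nu_t|_{t=1}=\mu_1+H_1p$, and over measurable $U:[0,1]\to\mathbb R^{\mathcal X\times\mathcal X}$ with $\dot\nu_t+\nabla\cdot U_t=0$ for a.e. $t\in[0,1]$.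 (Here $v^2/0$ is $0$ if $v=0$ and $\infty$ otherwise, and $\infty\cdot 0=0$; all actions take values in $[0,\infty]$.) **Theorem.** For all $\mu_0,\mu_1\in\mathcal M$, $$D_p^{a,b}(\mu_0,\mu_1)\le\mathcal W_p^{a,b}(\mu_0,\mu_1),$$ and the inequality is strict whenever $\mu_0-\mu_1\notin\mathrm{span}\{p\}$. -/

import Mathlib

open MeasureTheory Set
open scoped ENNReal

noncomputable section

namespace ShiftTransport

/-- The logarithmic mean `θ(u,v) = ∫₀¹ u^ξ v^(1-ξ) dξ` of nonnegative reals `u, v`. -/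
def logMean (u v : ℝ) : ℝ := ∫ ξ in (0 : ℝ)..1, u ^ ξ * v ^ (1 - ξ)

variable {X : Type*} [Fintype X]

/-- The mobility `μ̂(x,y) = θ(μ(x),μ(y))`. -/
def mobility (μ : X → ℝ) (x y : X) : ℝ := logMean (μ x) (μ y)

/-- The discrete gradient `∇ψ(x,y) = ψ(y) - ψ(x)`. -/
def grad (ψ : X → ℝ) (x y : X) : ℝ := ψ y - ψ x

/-- The discrete divergence `(∇·Ψ)(x) = ½ ∑_y (Ψ(x,y) - Ψ(y,x)) K(x,y)`. -/
def divergence (K : Matrix X X ℝ) (Ψ : X → X → ℝ) (x : X) : ℝ :=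
  1 / 2 * ∑ y, (Ψ x y - Ψ y x) * K x y

/-- The total mass `‖μ‖_{ϖ,1} = ∑_x ϖ(x) |μ(x)|`. -/
def mass (w : X → ℝ) (μ : X → ℝ) : ℝ := ∑ x, w x * |μ x|

/-- The squared seminorm `‖Φ‖_μ² = ½ ∑_{x,y} Φ(x,y)² μ̂(x,y) K(x,y) ϖ(x)`. -/
def normSq (K : Matrix X X ℝ) (w : X → ℝ) (μ : X → ℝ) (Φ : X → X → ℝ) : ℝ :=
  1 / 2 * ∑ x, ∑ y, Φ x y ^ 2 * mobility μ x y * K x y * w x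

/-- The density `α(v,s,t) = v² / θ(s,t)` with `0/0 = 0` and `v²/0 = ∞` for `v ≠ 0`. -/
def alpha (v s t : ℝ) : ℝ≥0∞ :=
  if logMean s t = 0 then (if v = 0 then 0 else ∞) else ENNReal.ofReal (v ^ 2 / logMean s t)

/-- The flux action `A'(μ,V) = ½ ∑_{x,y} α(V(x,y),μ(x),μ(y)) K(x,y) ϖ(x)`
(with the convention `∞ · 0 = 0`, so pairs with `K(x,y) = 0` do not contribute). -/
def fluxAction (K : Matrix X X ℝ) (w : X → ℝ) (μ : X → ℝ) (V : X → X → ℝ) : ℝ≥0∞ :=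
  1 / 2 * ∑ x, ∑ y, alpha (V x y) (μ x) (μ y) * ENNReal.ofReal (K x y * w x)

/-- `(μ_t, ψ_t, h_t)` solves the continuity equation with source direction `p` on `[0,1]`
and connects `μ₀` to `μ₁`. (Only the values at times in `[0,1]` matter.) -/
structure IsCE (K : Matrix X X ℝ) (p μ₀ μ₁ : X → ℝ)
    (μ : ℝ → X → ℝ) (ψ : ℝ → X → ℝ) (h : ℝ → ℝ) : Prop where
  nonneg : ∀ t ∈ Icc (0 : ℝ) 1, ∀ x, 0 ≤ μ t x
  ac : AbsolutelyContinuousOnInterval μ 0 1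
  measurable_potential : Measurable ψ
  measurable_source : Measurable h
  continuity : ∀ᵐ t ∂(volume.restrict (Icc (0 : ℝ) 1)), ∀ x,
    HasDerivAt (fun s => μ s x)
      (h t * p x - divergence K (fun y z => mobility (μ t) y z * grad (ψ t) y z) x) t
  left : μ 0 = μ₀
  right : μ 1 = μ₁

/-- The action `a² ∫₀¹ h_t² dt + b² ∫₀¹ ‖∇ψ_t‖²_{μ_t} dt`, with values in `[0,∞]`. -/
def potentialAction (K : Matrix X X ℝ) (w : X → ℝ) (a b : ℝ)
    (μ : ℝ → X → ℝ) (ψ : ℝ → X → ℝ) (h : ℝ → ℝ) : ℝ≥0∞ :=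
  ENNReal.ofReal (a ^ 2) * (∫⁻ t in Icc (0 : ℝ) 1, ENNReal.ofReal (h t ^ 2)) +
  ENNReal.ofReal (b ^ 2) *
    (∫⁻ t in Icc (0 : ℝ) 1, ENNReal.ofReal (normSq K w (μ t) (grad (ψ t))))

/-- The Benamou--Brenier-type distance `W_p^{a,b}(μ₀,μ₁)`. -/
def distW (K : Matrix X X ℝ) (w p : X → ℝ) (a b : ℝ) (μ₀ μ₁ : X → ℝ) : ℝ≥0∞ :=
  (⨅ (μ : ℝ → X → ℝ) (ψ : ℝ → X → ℝ) (h : ℝ → ℝ) (_ : IsCE K p μ₀ μ₁ μ ψ h),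
    potentialAction K w a b μ ψ h) ^ (1 / 2 : ℝ)

/-- `(H₀, H₁, ν_t, U_t)` is an admissible shift--transport quadruplet: `μ₀` and `μ₁` are shifted
by `H₀ p` and `H₁ p` to nonnegative densities of equal mass, which the `C¹` curve `ν` with flux
`U` connects without source. -/
structure IsST (K : Matrix X X ℝ) (w p μ₀ μ₁ : X → ℝ)
    (H₀ H₁ : ℝ) (ν : ℝ → X → ℝ) (U : ℝ → X → X → ℝ) : Prop where
  shift_left_nonneg : ∀ x, 0 ≤ μ₀ x + H₀ * p x
  shift_right_nonneg : ∀ x, 0 ≤ μ₁ x + H₁ * p x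
  mass_eq : mass w μ₀ + H₀ = mass w μ₁ + H₁
  nonneg : ∀ t ∈ Icc (0 : ℝ) 1, ∀ x, 0 ≤ ν t x
  contDiffOn : ContDiffOn ℝ 1 ν (Icc (0 : ℝ) 1)
  measurable_flux : Measurable U
  continuity : ∀ᵐ t ∂(volume.restrict (Icc (0 : ℝ) 1)), ∀ x,
    HasDerivAt (fun s => ν s x) (-divergence K (U t) x) t
  left : ∀ x, ν 0 x = μ₀ x + H₀ * p x
  right : ∀ x, ν 1 x = μ₁ x + H₁ * p x

/-- The action `a² (|H₀| + |H₁|)² + b² ∫₀¹ A'(ν_t,U_t) dt`, with values in `[0,∞]`. -/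
def shiftTransportAction (K : Matrix X X ℝ) (w : X → ℝ) (a b : ℝ)
    (H₀ H₁ : ℝ) (ν : ℝ → X → ℝ) (U : ℝ → X → X → ℝ) : ℝ≥0∞ :=
  ENNReal.ofReal (a ^ 2 * (|H₀| + |H₁|) ^ 2) +
  ENNReal.ofReal (b ^ 2) * (∫⁻ t in Icc (0 : ℝ) 1, fluxAction K w (ν t) (U t))

/-- The shift--transport distance `D_p^{a,b}(μ₀,μ₁)`. -/
def distD (K : Matrix X X ℝ) (w p : X → ℝ) (a b : ℝ) (μ₀ μ₁ : X → ℝ) : ℝ≥0∞ :=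
  ⨅ (H₀ : ℝ) (H₁ : ℝ) (ν : ℝ → X → ℝ) (U : ℝ → X → X → ℝ) (_ : IsST K w p μ₀ μ₁ H₀ H₁ ν U),
    shiftTransportAction K w a b H₀ H₁ ν U ^ (1 / 2 : ℝ)

end ShiftTransport

end

/-!
Let `(μ, ψ, h)` be a solution of the continuity equation with source, of finite action, and let
`R₀` be the maximum over `[0,1]` of `t ↦ ∫₀ᵗ h`. The shifted curve `ν t = μ t + r t • p` with
`r t = R₀ - ∫₀ᵗ h ≥ 0` has the same flux and no source, and its total shift `R = r 0 + r 1` is at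
most `∫ |h|`, so `R² ≤ ∫ h²`. The logarithmic mean is superadditive, so that the shift multiplies
the mobility by at least `1 + c * r t`, where `c` depends only on a bound of `μ`
(`mul_logMean_le_logMean_add`). Hence the flux costs no more along `ν` than along `μ`
(`fluxAction_shift_le`), and `distD ≤ distW`.

The curve `ν` is only absolutely continuous, whereas `distD` asks for `C¹` curves. Averages of `ν`
over short time windows are `C¹`, and the joint convexity of the action (a consequence of the
supporting linear functions of the logarithmic mean, `exists_linear_ge_logMean`) shows that the
averaging does not increase the action. A further shift by `ε p`, with `ε → 0`, keeps all
mobilities positive in this argument (`distD_sq_le_of_primitive`, `IsIntegralCE.distD_sq_le`).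

For the strict inequality no minimiser is needed: the gain is bounded below uniformly over all
curves of bounded action (`exists_uniform_gap`). If `μ₀ - μ₁` is not a multiple of `p`, then the
kinetic energy `E` satisfies `∫ √E ≥ κ > 0` with `κ` independent of the curve
(`exists_lower_bound_integral_sqrt`). Fix a small `η`, and let `[τ₀, τ₁]` be bounded by the first
and the last time at which `r ≤ η`.
* If `R` is small, increasing the shift by a small `ε` costs `O(a² ε (R + ε))` and saves a multiple
  of `ε κ²`.
* If a fixed part of the energy lies outside `[τ₀, τ₁]`, where `r ≥ η`, the shift saves a fixed
  amount.
* Otherwise, by Cauchy–Schwarz, `τ₁ - τ₀` is bounded below. The source achieves all but `2 η` of the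
  total shift outside `[τ₀, τ₁]`, and `(R - 2 η)² ≤ (1 - (τ₁ - τ₀)) ∫ h²` makes `∫ h²` exceed `R²`
  by a fixed amount.

If `distW` is infinite, strictness follows from `distD_lt_top`: by irreducibility every function of
mean zero is a divergence.
-/

namespace ShiftTransport

/-! ### The logarithmic mean -/

lemma rpow_mul_rpow_le {s t ξ : ℝ} (hs : 0 ≤ s) (ht : 0 ≤ t) (hξ : ξ ∈ Icc (0 : ℝ) 1) :
    s ^ ξ * t ^ (1 - ξ) ≤ ξ * s + (1 - ξ) * t :=
  Real.geom_mean_le_arith_mean2_weighted hξ.1 (by linarith [hξ.2]) hs ht (by ring)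

lemma intervalIntegrable_rpow_mul_rpow {s t : ℝ} (hs : 0 ≤ s) (ht : 0 ≤ t) :
    IntervalIntegrable (fun ξ : ℝ => s ^ ξ * t ^ (1 - ξ)) volume 0 1 := by
  rw [intervalIntegrable_iff_integrableOn_Icc_of_le zero_le_one]
  refine Measure.integrableOn_of_bounded (M := s + t) (by simp) ?_ ?_
  · exact ((measurable_const.pow measurable_id).mul
      (measurable_const.pow (measurable_const.sub measurable_id))).aestronglyMeasurable
  · filter_upwards [ae_restrict_mem measurableSet_Icc] with ξ hξ
    have h0 : 0 ≤ s ^ ξ * t ^ (1 - ξ) := by positivity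
    rw [Real.norm_of_nonneg h0]
    refine (rpow_mul_rpow_le hs ht hξ).trans ?_
    nlinarith [hξ.1, hξ.2]

lemma logMean_nonneg {s t : ℝ} (hs : 0 ≤ s) (ht : 0 ≤ t) : 0 ≤ logMean s t :=
  intervalIntegral.integral_nonneg zero_le_one fun ξ _ => by positivity

lemma logMean_le {s t M : ℝ} (hs : 0 ≤ s) (ht : 0 ≤ t) (hsM : s ≤ M) (htM : t ≤ M) :
    logMean s t ≤ M := by
  have := intervalIntegral.integral_mono_on zero_le_one (intervalIntegrable_rpow_mul_rpow hs ht)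
    (intervalIntegrable_const (μ := volume) (c := M)) fun ξ hξ =>
      (rpow_mul_rpow_le hs ht hξ).trans (by nlinarith [hξ.1, hξ.2])
  simpa [logMean] using this

lemma le_logMean {s t m : ℝ} (hm : 0 < m) (hs : m ≤ s) (ht : m ≤ t) : m ≤ logMean s t := by
  have := intervalIntegral.integral_mono_on zero_le_one
    (intervalIntegrable_const (μ := volume) (c := m))
    (intervalIntegrable_rpow_mul_rpow (hm.le.trans hs) (hm.le.trans ht)) fun ξ hξ => by
      calc m = m ^ ξ * m ^ (1 - ξ) := by rw [← Real.rpow_add hm]; simp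
        _ ≤ s ^ ξ * t ^ (1 - ξ) := by
          exact mul_le_mul (Real.rpow_le_rpow hm.le hs hξ.1)
            (Real.rpow_le_rpow hm.le ht (by linarith [hξ.2])) (by positivity)
            (Real.rpow_nonneg (hm.le.trans hs) _)
  simpa [logMean] using this

/-- The logarithmic mean is concave and positively homogeneous of degree one: at a point with
positive coordinates it has a supporting linear function. Integrate the weighted
arithmetic–geometric mean inequality for `s / S` and `t / T` against `S ^ ξ * T ^ (1 - ξ)`. -/
lemma exists_linear_ge_logMean {S T : ℝ} (hS : 0 < S) (hT : 0 < T) :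
    ∃ A B : ℝ, logMean S T = A * S + B * T ∧
      ∀ s t : ℝ, 0 ≤ s → 0 ≤ t → logMean s t ≤ A * s + B * t := by
  have hcont : Continuous fun ξ : ℝ => S ^ ξ * T ^ (1 - ξ) :=
    (Real.continuous_const_rpow hS.ne').mul
      ((Real.continuous_const_rpow hT.ne').comp (continuous_const.sub continuous_id))
  have hA : IntervalIntegrable (fun ξ : ℝ => ξ * (S ^ ξ * T ^ (1 - ξ))) volume 0 1 :=
    (continuous_id.mul hcont).intervalIntegrable _ _
  have hB : IntervalIntegrable (fun ξ : ℝ => (1 - ξ) * (S ^ ξ * T ^ (1 - ξ))) volume 0 1 :=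
    ((continuous_const.sub continuous_id).mul hcont).intervalIntegrable _ _
  have key : ∀ s t : ℝ,
      (∫ ξ in (0 : ℝ)..1, ξ * (S ^ ξ * T ^ (1 - ξ))) / S * s +
        (∫ ξ in (0 : ℝ)..1, (1 - ξ) * (S ^ ξ * T ^ (1 - ξ))) / T * t =
      ∫ ξ in (0 : ℝ)..1, (ξ * (S ^ ξ * T ^ (1 - ξ)) * (s / S) +
        (1 - ξ) * (S ^ ξ * T ^ (1 - ξ)) * (t / T)) := by
    intro s t
    rw [intervalIntegral.integral_add (hA.mul_const _) (hB.mul_const _),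
      intervalIntegral.integral_mul_const, intervalIntegral.integral_mul_const]
    ring
  refine ⟨(∫ ξ in (0 : ℝ)..1, ξ * (S ^ ξ * T ^ (1 - ξ))) / S,
    (∫ ξ in (0 : ℝ)..1, (1 - ξ) * (S ^ ξ * T ^ (1 - ξ))) / T, ?_, fun s t hs ht => ?_⟩
  · rw [key, logMean]
    congr 1
    ext ξ
    rw [div_self hS.ne', div_self hT.ne']
    ring
  · rw [key, logMean]
    refine intervalIntegral.integral_mono_on zero_le_one (intervalIntegrable_rpow_mul_rpow hs ht)
      ((hA.mul_const _).add (hB.mul_const _)) fun ξ hξ => ?_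
    have h1 := rpow_mul_rpow_le (div_nonneg hs hS.le) (div_nonneg ht hT.le) hξ
    have hpos : 0 ≤ S ^ ξ * T ^ (1 - ξ) := by positivity
    have h2 : s ^ ξ * t ^ (1 - ξ) =
        S ^ ξ * T ^ (1 - ξ) * ((s / S) ^ ξ * (t / T) ^ (1 - ξ)) := by
      rw [Real.div_rpow hs hS.le, Real.div_rpow ht hT.le]
      have := (Real.rpow_pos_of_pos hS ξ).ne'
      have := (Real.rpow_pos_of_pos hT (1 - ξ)).ne'
      field_simp
    rw [h2]
    calc _ ≤ S ^ ξ * T ^ (1 - ξ) * (ξ * (s / S) + (1 - ξ) * (t / T)) := by gcongr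
      _ = _ := by ring

lemma logMean_add_le {s t u v : ℝ} (hs : 0 ≤ s) (ht : 0 ≤ t) (hu : 0 < u) (hv : 0 < v) :
    logMean s t + logMean u v ≤ logMean (s + u) (t + v) := by
  obtain ⟨A, B, hAB, hle⟩ :=
    exists_linear_ge_logMean (add_pos_of_nonneg_of_pos hs hu) (add_pos_of_nonneg_of_pos ht hv)
  linarith [hle s t hs ht, hle u v hu.le hv.le]

/-- Quantitative gain of the mobility under a shift: on densities bounded by `M`, a shift by `ρ`
times a density at least `c * M` multiplies the logarithmic mean by at least `1 + c * ρ`. -/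
lemma mul_logMean_le_logMean_add {s t u v M c ρ : ℝ} (hs : 0 ≤ s) (ht : 0 ≤ t)
    (hsM : s ≤ M) (htM : t ≤ M) (hM : 0 < M) (hc : 0 < c) (hu : c * M ≤ u) (hv : c * M ≤ v)
    (hρ : 0 < ρ) :
    logMean s t * (1 + c * ρ) ≤ logMean (s + ρ * u) (t + ρ * v) := by
  have hpos : 0 < ρ * (c * M) := by positivity
  have hu' : ρ * (c * M) ≤ ρ * u := by gcongr
  have hv' : ρ * (c * M) ≤ ρ * v := by gcongr
  have h1 := logMean_add_le hs ht (hpos.trans_le hu') (hpos.trans_le hv')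
  have h2 := le_logMean hpos hu' hv'
  have h3 := mul_le_mul_of_nonneg_right (logMean_le hs ht hsM htM) (mul_pos hc hρ).le
  linarith

lemma measurable_logMean : Measurable fun q : ℝ × ℝ => logMean q.1 q.2 := by
  have : StronglyMeasurable fun z : (ℝ × ℝ) × ℝ => z.1.1 ^ z.2 * z.1.2 ^ (1 - z.2) :=
    ((measurable_fst.fst.pow measurable_snd).mul
      (measurable_fst.snd.pow (measurable_const.sub measurable_snd))).stronglyMeasurable
  simp_rw [logMean, intervalIntegral.integral_of_le zero_le_one]
  exact (this.integral_prod_right (ν := volume.restrict (Ioc (0 : ℝ) 1))).measurable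

lemma measurable_alpha : Measurable fun q : ℝ × ℝ × ℝ => alpha q.1 q.2.1 q.2.2 := by
  have hθ : Measurable fun q : ℝ × ℝ × ℝ => logMean q.2.1 q.2.2 :=
    measurable_logMean.comp measurable_snd
  refine Measurable.ite (hθ (measurableSet_singleton 0))
    (Measurable.ite (measurable_fst (measurableSet_singleton 0)) measurable_const
      measurable_const) ?_
  exact ((measurable_fst.pow_const 2).div hθ).ennreal_ofReal

lemma alpha_of_pos {v s t : ℝ} (h : 0 < logMean s t) :
    alpha v s t = ENNReal.ofReal (v ^ 2 / logMean s t) := by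
  simp [alpha, h.ne']

/-! ### Irreducible reversible kernels -/

lemma forall_of_isIrreducible {X : Type*} {K : Matrix X X ℝ} (hK : K.IsIrreducible) {S : X → Prop}
    (hS : ∀ x y, S x → 0 < K x y → S y) {x : X} (hx : S x) (y : X) : S y := by
  let : Quiver X := K.toQuiver
  obtain ⟨q, -⟩ := hK.connected x y
  induction q with
  | nil => exact hx
  | cons _ e ih => exact hS _ _ ih e.down

section Kernel

variable {X : Type*} [Fintype X]

lemma exists_pos_le {p : X → ℝ} (hp : ∀ x, 0 < p x) : ∃ m, 0 < m ∧ ∀ x, m ≤ p x := by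
  rcases isEmpty_or_nonempty X with h | h
  · exact ⟨1, one_pos, fun x => h.elim x⟩
  · obtain ⟨x, hx⟩ := Finite.exists_min p
    exact ⟨p x, hp x, hx⟩

lemma exists_pos_forall_le (p : X → ℝ) : ∃ M, 0 < M ∧ ∀ x, p x ≤ M :=
  ⟨∑ x, |p x| + 1, by positivity, fun x => by
    have := Finset.single_le_sum (fun x _ => abs_nonneg (p x)) (Finset.mem_univ x)
    linarith [le_abs_self (p x)]⟩

lemma weight_pos {K : Matrix X X ℝ} (hK : K.IsIrreducible) {w : X → ℝ}
    (hw : ∀ x, 0 ≤ w x) (hw_sum : ∑ x, w x = 1) (hrev : ∀ x y, K x y * w x = K y x * w y)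
    (x : X) : 0 < w x := by
  obtain ⟨x₀, -, h₀⟩ : ∃ x ∈ Finset.univ, w x ≠ 0 :=
    Finset.exists_ne_zero_of_sum_ne_zero (by rw [hw_sum]; exact one_ne_zero)
  refine forall_of_isIrreducible hK (S := fun x => 0 < w x) (fun y z hy hyz => ?_)
    ((hw x₀).lt_of_ne' h₀) x
  refine (hw z).lt_of_ne' fun hz => ?_
  have := hrev y z
  rw [hz, mul_zero] at this
  exact (mul_pos hyz hy).ne' this

lemma sum_mul_divergence {K : Matrix X X ℝ} {w : X → ℝ}
    (hrev : ∀ x y, K x y * w x = K y x * w y) (Ψ : X → X → ℝ) :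
    ∑ x, w x * divergence K Ψ x = 0 := by
  have h : ∀ x, w x * divergence K Ψ x =
      1 / 2 * (∑ y, Ψ x y * (K x y * w x) - ∑ y, Ψ y x * (K y x * w y)) := by
    intro x
    rw [divergence, ← Finset.sum_sub_distrib, Finset.mul_sum, Finset.mul_sum, Finset.mul_sum]
    refine Finset.sum_congr rfl fun y _ => ?_
    rw [← hrev x y]
    ring
  simp_rw [h, ← Finset.mul_sum, Finset.sum_sub_distrib]
  rw [Finset.sum_comm, sub_self, mul_zero]

lemma mass_of_nonneg {w μ : X → ℝ} (hμ : ∀ x, 0 ≤ μ x) : mass w μ = ∑ x, w x * μ x := by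
  simp [mass, abs_of_nonneg (hμ _)]

/-- The divergence as a linear map on fluxes. -/
noncomputable def divergenceLinear (K : Matrix X X ℝ) : (X → X → ℝ) →ₗ[ℝ] (X → ℝ) where
  toFun := divergence K
  map_add' Φ Ψ := by
    ext x
    simp only [divergence, Pi.add_apply, ← mul_add, ← Finset.sum_add_distrib]
    congr 1
    exact Finset.sum_congr rfl fun y _ => by ring
  map_smul' r Ψ := by
    ext x
    simp only [divergence, Pi.smul_apply, smul_eq_mul, RingHom.id_apply, Finset.mul_sum]
    exact Finset.sum_congr rfl fun y _ => by ring

@[simp] lemma divergenceLinear_apply (K : Matrix X X ℝ) (Ψ : X → X → ℝ) :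
    divergenceLinear K Ψ = divergence K Ψ := rfl

/-- A function of zero mean is a divergence: a linear functional that vanishes on all divergences
has a density with respect to `w` that is constant along the edges, hence constant. -/
lemma exists_divergence_eq {K : Matrix X X ℝ} (hK : K.IsIrreducible) {w : X → ℝ}
    (hw : ∀ x, 0 < w x) (hrev : ∀ x y, K x y * w x = K y x * w y) {f : X → ℝ}
    (hf : ∑ x, w x * f x = 0) : ∃ U, divergence K U = f := by
  classical
  by_contra hne
  have hmem : f ∉ LinearMap.range (divergenceLinear K) := fun ⟨U, hU⟩ => hne ⟨U, hU⟩
  obtain ⟨φ, hφf, hφ⟩ := Submodule.exists_le_ker_of_notMem hmem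
  have hrep : ∀ g : X → ℝ, φ g = ∑ x, g x * φ (Pi.single x 1) := fun g => by
    conv_lhs => rw [pi_eq_sum_univ' g]
    simp
  have hedge : ∀ x y, φ (Pi.single x 1) * K x y = φ (Pi.single y 1) * K y x := by
    intro x y
    have h0 : φ (divergence K (Pi.single x (Pi.single y 1))) = 0 :=
      LinearMap.mem_ker.1 (hφ ⟨_, rfl⟩)
    have h1 : divergence K (Pi.single x (Pi.single y 1)) =
        (1 / 2 : ℝ) • (K x y • Pi.single x (1 : ℝ) - K y x • Pi.single y (1 : ℝ)) := by
      ext z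
      have e1 : ∑ u, (Pi.single x (Pi.single y 1) : X → X → ℝ) z u * K z u =
          K x y * (Pi.single x 1 : X → ℝ) z := by
        by_cases hz : z = x
        · subst hz; simp [Pi.single_apply]
        · simp [hz]
      have e2 : ∑ u, (Pi.single x (Pi.single y 1) : X → X → ℝ) u z * K z u =
          K y x * (Pi.single y 1 : X → ℝ) z := by
        rw [Finset.sum_eq_single x (fun u _ hu => by simp [hu]) (by simp)]
        by_cases hz : z = y
        · subst hz; simp
        · simp [hz]
      simp [divergence, sub_mul, Finset.sum_sub_distrib, e1, e2]
    rw [h1] at h0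
    simp only [map_smul, map_sub, smul_eq_mul] at h0
    linarith
  have hconst : ∀ x y, φ (Pi.single x 1) / w x = φ (Pi.single y 1) / w y := by
    intro x y
    refine forall_of_isIrreducible hK
      (S := fun y => φ (Pi.single x 1) / w x = φ (Pi.single y 1) / w y) ?_ rfl y
    intro y z hy hyz
    rw [hy, div_eq_div_iff (hw y).ne' (hw z).ne']
    refine mul_right_cancel₀ hyz.ne' ?_
    calc _ = φ (Pi.single y 1) * K y z * w z := by ring
      _ = φ (Pi.single z 1) * (K z y * w z) := by rw [hedge]; ring
      _ = _ := by rw [← hrev]; ring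
  refine hφf ?_
  rw [hrep]
  rcases isEmpty_or_nonempty X with h | ⟨⟨x₀⟩⟩
  · simp
  calc ∑ x, f x * φ (Pi.single x 1)
      = ∑ x, φ (Pi.single x₀ 1) / w x₀ * (w x * f x) := by
        refine Finset.sum_congr rfl fun x _ => ?_
        rw [hconst x₀ x]
        have := (hw x).ne'
        field_simp
    _ = 0 := by rw [← Finset.mul_sum, hf, mul_zero]

/-! ### Finiteness of the shift–transport distance -/

lemma distD_sq_le {K : Matrix X X ℝ} {w p μ₀ μ₁ : X → ℝ} {a b H₀ H₁ : ℝ}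
    {ν : ℝ → X → ℝ} {U : ℝ → X → X → ℝ} (h : IsST K w p μ₀ μ₁ H₀ H₁ ν U) :
    distD K w p a b μ₀ μ₁ ^ 2 ≤ shiftTransportAction K w a b H₀ H₁ ν U := by
  have h1 : distD K w p a b μ₀ μ₁ ≤ shiftTransportAction K w a b H₀ H₁ ν U ^ (1 / 2 : ℝ) :=
    iInf_le_of_le H₀ <| iInf_le_of_le H₁ <| iInf_le_of_le ν <| iInf_le_of_le U <|
      iInf_le_of_le h le_rfl
  calc _ ≤ (shiftTransportAction K w a b H₀ H₁ ν U ^ (1 / 2 : ℝ)) ^ 2 := by gcongr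
    _ = _ := by rw [← ENNReal.rpow_natCast, ← ENNReal.rpow_mul]; norm_num

lemma fluxAction_le_of_le_logMean {K : Matrix X X ℝ} {w ν : X → ℝ} {V : X → X → ℝ}
    {G : X → X → ℝ} (hG : ∀ x y, 0 < G x y) (hν : ∀ x y, G x y ≤ logMean (ν x) (ν y))
    (hKw : ∀ x y, 0 ≤ K x y * w x) :
    fluxAction K w ν V ≤
      ENNReal.ofReal (1 / 2 * ∑ x, ∑ y, V x y ^ 2 / G x y * (K x y * w x)) := by
  have hnn : ∀ x y, 0 ≤ V x y ^ 2 / G x y := fun x y => div_nonneg (sq_nonneg _) (hG x y).le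
  rw [fluxAction, ENNReal.ofReal_mul (by norm_num), ENNReal.ofReal_sum_of_nonneg fun x _ =>
    Finset.sum_nonneg fun y _ => mul_nonneg (hnn x y) (hKw x y)]
  have h2 : (1 / 2 : ℝ≥0∞) = ENNReal.ofReal (1 / 2) := by
    rw [ENNReal.ofReal_div_of_pos two_pos]; simp
  rw [h2]
  gcongr with x _
  rw [ENNReal.ofReal_sum_of_nonneg fun y _ => mul_nonneg (hnn x y) (hKw x y)]
  gcongr with y _
  rw [ENNReal.ofReal_mul (hnn x y), alpha_of_pos ((hG x y).trans_le (hν x y))]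
  gcongr
  · exact hG x y
  · exact hν x y

/-- Large shifts of equal total mass make both endpoints bounded below; the segment between them,
with a flux that does not depend on time, has finite action. -/
lemma distD_lt_top {K : Matrix X X ℝ} (hK : K.IsIrreducible) {w p μ₀ μ₁ : X → ℝ}
    (hw : ∀ x, 0 < w x) (hrev : ∀ x y, K x y * w x = K y x * w y)
    (hp : ∀ x, 0 < p x) (hpm : mass w p = 1) (hμ₀ : ∀ x, 0 ≤ μ₀ x) (hμ₁ : ∀ x, 0 ≤ μ₁ x)
    (a b : ℝ) : distD K w p a b μ₀ μ₁ < ∞ := by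
  have hKw : ∀ x y, 0 ≤ K x y * w x := fun x y => mul_nonneg (hK.nonneg x y) (hw x).le
  have hm₀ : 0 ≤ mass w μ₀ := Finset.sum_nonneg fun x _ => mul_nonneg (hw x).le (abs_nonneg _)
  have hm₁ : 0 ≤ mass w μ₁ := Finset.sum_nonneg fun x _ => mul_nonneg (hw x).le (abs_nonneg _)
  obtain ⟨m, hm, hmp⟩ := exists_pos_le hp
  set H₀ := 1 + mass w μ₁ with hH₀
  set H₁ := 1 + mass w μ₀ with hH₁
  obtain ⟨U, hU⟩ := exists_divergence_eq hK hw hrev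
    (f := fun x => (μ₀ x + H₀ * p x) - (μ₁ x + H₁ * p x)) (by
      have e : ∀ x, w x * ((μ₀ x + H₀ * p x) - (μ₁ x + H₁ * p x)) =
          w x * μ₀ x - w x * μ₁ x + (H₀ - H₁) * (w x * p x) := fun x => by ring
      simp_rw [e]
      rw [Finset.sum_add_distrib, Finset.sum_sub_distrib, ← Finset.mul_sum,
        ← mass_of_nonneg hμ₀, ← mass_of_nonneg hμ₁, ← mass_of_nonneg fun x => (hp x).le, hpm]
      ring)
  have h₀ : ∀ x, m ≤ μ₀ x + H₀ * p x := fun x => by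
    nlinarith [hμ₀ x, hmp x, mul_nonneg hm₁ (hp x).le]
  have h₁ : ∀ x, m ≤ μ₁ x + H₁ * p x := fun x => by
    nlinarith [hμ₁ x, hmp x, mul_nonneg hm₀ (hp x).le]
  set ν : ℝ → X → ℝ := fun t x => (μ₀ x + H₀ * p x) - t * divergence K U x with hν
  have hνm : ∀ t ∈ Icc (0 : ℝ) 1, ∀ x, m ≤ ν t x := fun t ht x => by
    have e : ν t x = (1 - t) * (μ₀ x + H₀ * p x) + t * (μ₁ x + H₁ * p x) := by
      simp only [hν, hU]; ring
    rw [e]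
    nlinarith [h₀ x, h₁ x, ht.1, ht.2]
  have hST : IsST K w p μ₀ μ₁ H₀ H₁ ν fun _ => U :=
    { shift_left_nonneg := fun x => hm.le.trans (h₀ x)
      shift_right_nonneg := fun x => hm.le.trans (h₁ x)
      mass_eq := by rw [hH₀, hH₁]; ring
      nonneg := fun t ht x => hm.le.trans (hνm t ht x)
      contDiffOn := contDiffOn_pi.2 fun x => by
        simp only [hν]
        exact (contDiff_const.sub (contDiff_id.mul contDiff_const)).contDiffOn
      measurable_flux := measurable_const
      continuity := Filter.Eventually.of_forall fun t x => by
        simpa using ((hasDerivAt_id t).mul_const (divergence K U x)).const_sub (μ₀ x + H₀ * p x)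
      left := fun x => by simp [hν]
      right := fun x => by simp [hν, hU] }
  have h1 : shiftTransportAction K w a b H₀ H₁ ν (fun _ => U) < ∞ := by
    refine ENNReal.add_lt_top.2 ⟨ENNReal.ofReal_lt_top,
      ENNReal.mul_lt_top ENNReal.ofReal_lt_top ?_⟩
    calc ∫⁻ t in Icc (0 : ℝ) 1, fluxAction K w (ν t) U
        ≤ ∫⁻ _ in Icc (0 : ℝ) 1,
          ENNReal.ofReal (1 / 2 * ∑ x, ∑ y, U x y ^ 2 / m * (K x y * w x)) :=
          setLIntegral_mono measurable_const fun t ht =>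
            fluxAction_le_of_le_logMean (fun _ _ => hm)
              (fun x y => le_logMean hm (hνm t ht x) (hνm t ht y)) hKw
      _ < ∞ := by
        rw [setLIntegral_const]
        exact ENNReal.mul_lt_top ENNReal.ofReal_lt_top (by simp)
  have h2 := (distD_sq_le (a := a) (b := b) hST).trans_lt h1
  by_contra htop
  rw [not_lt, top_le_iff] at htop
  simp [htop] at h2

end Kernel

/-! ### Joint convexity of the flux action -/

section Jensen

variable {X : Type*} [Fintype X]

/-- The action density lies above its supporting linear functions. -/
lemma ofReal_linear_le_alpha {v s t l A B : ℝ} (hs : 0 ≤ s) (ht : 0 ≤ t)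
    (hle : logMean s t ≤ A * s + B * t) :
    ENNReal.ofReal (2 * l * v - l ^ 2 * (A * s + B * t)) ≤ alpha v s t := by
  have h0 := logMean_nonneg hs ht
  have h1 : 2 * l * v - l ^ 2 * (A * s + B * t) ≤ 2 * l * v - l ^ 2 * logMean s t := by
    nlinarith [sq_nonneg l]
  rcases h0.eq_or_lt with h | h
  · by_cases hv : v = 0
    · rw [ENNReal.ofReal_eq_zero.2 (by rw [← h] at h1; rw [hv] at h1 ⊢; linarith)]
      exact bot_le
    · simp [alpha, ← h, hv]
  · rw [alpha_of_pos h]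
    refine ENNReal.ofReal_le_ofReal (h1.trans ?_)
    rw [le_div_iff₀ h]
    nlinarith [sq_nonneg (v - l * logMean s t)]

lemma ofReal_integral_le_lintegral {Ω : Type*} [MeasurableSpace Ω] {P : Measure Ω} {f : Ω → ℝ}
    (hf : Integrable f P) : ENNReal.ofReal (∫ u, f u ∂P) ≤ ∫⁻ u, ENNReal.ofReal (f u) ∂P := by
  calc ENNReal.ofReal (∫ u, f u ∂P) ≤ ENNReal.ofReal (∫ u, max (f u) 0 ∂P) :=
        ENNReal.ofReal_le_ofReal (integral_mono hf hf.pos_part fun u => le_max_left _ _)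
    _ = ∫⁻ u, ENNReal.ofReal (max (f u) 0) ∂P :=
        ofReal_integral_eq_lintegral_ofReal hf.pos_part
          (Filter.Eventually.of_forall fun u => le_max_right _ _)
    _ = ∫⁻ u, ENNReal.ofReal (f u) ∂P := by simp [ENNReal.ofReal_max]

/-- Jensen's inequality for the action density, at averages with positive coordinates. -/
lemma alpha_integral_le {Ω : Type*} [MeasurableSpace Ω] {P : Measure Ω}
    {v s t : Ω → ℝ} (hv : Integrable v P) (hs : Integrable s P) (ht : Integrable t P)
    (hs0 : ∀ u, 0 ≤ s u) (ht0 : ∀ u, 0 ≤ t u) (hS : 0 < ∫ u, s u ∂P) (hT : 0 < ∫ u, t u ∂P) :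
    alpha (∫ u, v u ∂P) (∫ u, s u ∂P) (∫ u, t u ∂P) ≤ ∫⁻ u, alpha (v u) (s u) (t u) ∂P := by
  obtain ⟨A, B, hAB, hle⟩ := exists_linear_ge_logMean hS hT
  have hθ : 0 < logMean (∫ u, s u ∂P) (∫ u, t u ∂P) :=
    (lt_min hS hT).trans_le (le_logMean (lt_min hS hT) (min_le_left _ _) (min_le_right _ _))
  set θ := logMean (∫ u, s u ∂P) (∫ u, t u ∂P)
  set l := (∫ u, v u ∂P) / θ with hl
  have hst : Integrable (fun u => A * s u + B * t u) P := (hs.const_mul A).add (ht.const_mul B)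
  have hlin : Integrable (fun u => 2 * l * v u - l ^ 2 * (A * s u + B * t u)) P :=
    (hv.const_mul _).sub (hst.const_mul _)
  have heq : (∫ u, v u ∂P) ^ 2 / θ =
      ∫ u, (2 * l * v u - l ^ 2 * (A * s u + B * t u)) ∂P := by
    rw [integral_sub (hv.const_mul _) (hst.const_mul _),
      integral_const_mul, integral_const_mul, integral_add (hs.const_mul A) (ht.const_mul B),
      integral_const_mul, integral_const_mul, ← hAB, hl]
    field_simp
    ring
  rw [alpha_of_pos hθ, heq]
  exact (ofReal_integral_le_lintegral hlin).trans
    (lintegral_mono fun u => ofReal_linear_le_alpha (hs0 u) (ht0 u) (hle _ _ (hs0 u) (ht0 u)))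

lemma measurable_fluxAction {Ω : Type*} [MeasurableSpace Ω] (K : Matrix X X ℝ) (w : X → ℝ)
    {N : Ω → X → ℝ} {V : Ω → X → X → ℝ} (hN : ∀ x, Measurable fun u => N u x)
    (hV : ∀ x y, Measurable fun u => V u x y) :
    Measurable fun u => fluxAction K w (N u) (V u) := by
  refine Measurable.const_mul (Finset.measurable_fun_sum _ fun x _ =>
    Finset.measurable_fun_sum _ fun y _ => Measurable.mul_const ?_ _) _
  exact measurable_alpha.comp ((hV x y).prodMk ((hN x).prodMk (hN y)))

lemma fluxAction_integral_le {Ω : Type*} [MeasurableSpace Ω] {P : Measure Ω}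
    (K : Matrix X X ℝ) (w : X → ℝ) {N : Ω → X → ℝ} {V : Ω → X → X → ℝ}
    (hNm : ∀ x, Measurable fun u => N u x) (hVm : ∀ x y, Measurable fun u => V u x y)
    (hN : ∀ x, Integrable (fun u => N u x) P) (hV : ∀ x y, Integrable (fun u => V u x y) P)
    (hN0 : ∀ u x, 0 ≤ N u x) (hpos : ∀ x, 0 < ∫ u, N u x ∂P) :
    fluxAction K w (fun x => ∫ u, N u x ∂P) (fun x y => ∫ u, V u x y ∂P) ≤
      ∫⁻ u, fluxAction K w (N u) (V u) ∂P := by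
  have hα : ∀ x y, Measurable fun u => alpha (V u x y) (N u x) (N u y) := fun x y =>
    measurable_alpha.comp ((hVm x y).prodMk ((hNm x).prodMk (hNm y)))
  simp only [fluxAction]
  rw [lintegral_const_mul _ (Finset.measurable_fun_sum _ fun x _ =>
    Finset.measurable_fun_sum _ fun y _ => (hα x y).mul_const _),
    lintegral_finsetSum _ fun x _ => Finset.measurable_fun_sum _ fun y _ => (hα x y).mul_const _]
  gcongr with x _
  rw [lintegral_finsetSum _ fun y _ => (hα x y).mul_const _]
  gcongr with y _
  rw [lintegral_mul_const _ (hα x y)]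
  gcongr
  exact alpha_integral_le (hV x y) (hN x) (hN y) (fun u => hN0 u x) (fun u => hN0 u y)
    (hpos x) (hpos y)

lemma alpha_mul {c : ℝ} (hc : 0 < c) {v s t : ℝ} :
    alpha (c * v) s t = ENNReal.ofReal (c ^ 2) * alpha v s t := by
  have hc2 : ENNReal.ofReal (c ^ 2) ≠ 0 := by simp [hc.ne']
  unfold alpha
  split_ifs with h1 h2 h3 h3
  · simp
  · simp [hc.ne', h3] at h2
  · simp [h3] at h2
  · rw [ENNReal.mul_top hc2]
  · rw [← ENNReal.ofReal_mul (sq_nonneg c)]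
    congr 1
    ring

lemma fluxAction_mul (K : Matrix X X ℝ) (w ν : X → ℝ) (V : X → X → ℝ) {c : ℝ} (hc : 0 < c) :
    fluxAction K w ν (fun x y => c * V x y) = ENNReal.ofReal (c ^ 2) * fluxAction K w ν V := by
  simp only [fluxAction, alpha_mul hc, Finset.mul_sum]
  exact Finset.sum_congr rfl fun x _ => Finset.sum_congr rfl fun y _ => by ring

lemma alpha_zero (s t : ℝ) : alpha 0 s t = 0 := by simp [alpha]

lemma fluxAction_zero (K : Matrix X X ℝ) (w ν : X → ℝ) : fluxAction K w ν 0 = 0 := by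
  simp [fluxAction, alpha_zero]

end Jensen

/-! ### Time averages of a curve -/

lemma lintegral_comp_add_mul {F : ℝ → ℝ≥0∞} (hF : Measurable F) {κ : ℝ} (hκ : 0 < κ) (c : ℝ) :
    ∫⁻ t, F (c + κ * t) = ENNReal.ofReal κ⁻¹ * ∫⁻ t, F t := by
  have h := lintegral_map (μ := volume) (f := fun s => F (c + s)) (g := fun t : ℝ => κ * t)
    (hF.comp (measurable_const_add c)) (measurable_const_mul κ)
  rw [Real.map_volume_mul_left hκ.ne', lintegral_smul_measure, lintegral_add_left_eq_self,
    abs_of_pos (inv_pos.2 hκ)] at h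
  rw [← h, smul_eq_mul]

lemma intervalIntegral_comp_add_mul_eq (f : ℝ → ℝ) (hf : ∀ s t, IntervalIntegrable f volume s t)
    {δ : ℝ} (hδ : 0 < δ) (t : ℝ) :
    ∫ u in (0 : ℝ)..1, f (t + δ * u) =
      δ⁻¹ * ((∫ s in (0 : ℝ)..(t + δ), f s) - ∫ s in (0 : ℝ)..t, f s) := by
  rw [intervalIntegral.integral_comp_add_mul f hδ.ne' t,
    intervalIntegral.integral_interval_sub_left (hf _ _) (hf _ _)]
  simp

/-- The average over `[t, t + δ]` of a primitive of `f'` is a primitive of the average of `f'`. -/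
lemma hasDerivAt_average {f f' : ℝ → ℝ} (hf' : ∀ s t, IntervalIntegrable f' volume s t)
    (hf : ∀ t, f t = f 0 + ∫ s in (0 : ℝ)..t, f' s) {δ : ℝ} (hδ : 0 < δ) (t : ℝ) :
    HasDerivAt (fun t => ∫ u in (0 : ℝ)..1, f (t + δ * u))
      (∫ u in (0 : ℝ)..1, f' (t + δ * u)) t := by
  have hfc : Continuous f := by
    rw [show f = fun t => f 0 + ∫ s in (0 : ℝ)..t, f' s from funext hf]
    exact continuous_const.add (intervalIntegral.continuous_primitive hf' 0)
  have hG : ∀ t, HasDerivAt (fun t => ∫ s in (0 : ℝ)..t, f s) (f t) t := fun t =>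
    intervalIntegral.integral_hasDerivAt_right (hfc.intervalIntegrable _ _)
      (hfc.stronglyMeasurableAtFilter _ _) hfc.continuousAt
  have h1 := (((hG (t + δ)).comp_add_const t δ).sub (hG t)).const_mul δ⁻¹
  rw [intervalIntegral_comp_add_mul_eq f' hf' hδ]
  have h2 : f (t + δ) - f t = (∫ s in (0 : ℝ)..(t + δ), f' s) - ∫ s in (0 : ℝ)..t, f' s := by
    rw [hf (t + δ), hf t]; ring
  rw [← h2]
  refine h1.congr_of_eventuallyEq (Filter.Eventually.of_forall fun s => ?_)
  exact intervalIntegral_comp_add_mul_eq f (fun _ _ => hfc.intervalIntegrable _ _) hδ s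

lemma continuous_average {f : ℝ → ℝ} (hf : ∀ s t, IntervalIntegrable f volume s t)
    {δ : ℝ} (hδ : 0 < δ) : Continuous fun t => ∫ u in (0 : ℝ)..1, f (t + δ * u) := by
  simp_rw [intervalIntegral_comp_add_mul_eq f hf hδ]
  have := intervalIntegral.continuous_primitive hf 0
  exact continuous_const.mul ((this.comp (continuous_add_const δ)).sub this)

section Averaging

variable {X : Type*} [Fintype X]

lemma integral_divergence {Ω : Type*} [MeasurableSpace Ω] {P : Measure Ω} (K : Matrix X X ℝ)
    {V : Ω → X → X → ℝ} (hV : ∀ x y, Integrable (fun u => V u x y) P) (x : X) :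
    ∫ u, divergence K (V u) x ∂P = divergence K (fun x y => ∫ u, V u x y ∂P) x := by
  have hint : ∀ y, Integrable (fun u => (V u x y - V u y x) * K x y) P :=
    fun y => ((hV x y).sub (hV y x)).mul_const (K x y)
  simp only [divergence]
  rw [integral_const_mul, integral_finsetSum _ fun y _ => hint y]
  congr 1
  refine Finset.sum_congr rfl fun y _ => ?_
  rw [integral_mul_const, integral_sub (hV x y) (hV y x)]

lemma integrable_divergence {Ω : Type*} [MeasurableSpace Ω] {P : Measure Ω} (K : Matrix X X ℝ)
    {V : Ω → X → X → ℝ} (hV : ∀ x y, Integrable (fun u => V u x y) P) (x : X) :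
    Integrable (fun u => divergence K (V u) x) P :=
  (integrable_finsetSum _ fun y _ => ((hV x y).sub (hV y x)).mul_const (K x y)).const_mul _

/-- The `C¹` regularity demanded of the curves in `distD` costs nothing: the curve below is only
absolutely continuous. Extended by constants outside `[0,1]`, its averages over `[t, t + δ]` form a
`C¹` curve with the same endpoints over the longer interval `[-δ, 1]`; by joint convexity the
averaging does not increase the action, and rescaling time to `[0,1]` costs a factor `1 + δ`. -/
theorem distD_sq_le_of_primitive {K : Matrix X X ℝ} {w p μ₀ μ₁ : X → ℝ} {a b H₀ H₁ : ℝ}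
    {N : ℝ → X → ℝ} {V : ℝ → X → X → ℝ} (hmass : mass w μ₀ + H₀ = mass w μ₁ + H₁)
    (hVm : ∀ x y, Measurable fun t => V t x y)
    (hVi : ∀ x y, Integrable (fun t => V t x y))
    (hV0 : ∀ t ∉ Ioc (0 : ℝ) 1, V t = 0)
    (hN : ∀ t x, N t x = N 0 x + ∫ s in (0 : ℝ)..t, -divergence K (V s) x)
    (hpos : ∀ t ∈ Icc (0 : ℝ) 1, ∀ x, 0 < N t x)
    (hleft : ∀ x, N 0 x = μ₀ x + H₀ * p x) (hright : ∀ x, N 1 x = μ₁ x + H₁ * p x) :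
    distD K w p a b μ₀ μ₁ ^ 2 ≤ ENNReal.ofReal (a ^ 2 * (|H₀| + |H₁|) ^ 2) +
      ENNReal.ofReal (b ^ 2) * ∫⁻ t in Icc (0 : ℝ) 1, fluxAction K w (N t) (V t) := by
  have hVii : ∀ x y s t, IntervalIntegrable (fun t => V t x y) volume s t :=
    fun x y s t => (hVi x y).intervalIntegrable
  have hDii : ∀ x s t, IntervalIntegrable (fun t => -divergence K (V t) x) volume s t :=
    fun x s t => (integrable_divergence K hVi x).neg.intervalIntegrable
  have hNc : ∀ x, Continuous fun t => N t x := fun x => by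
    rw [show (fun t => N t x) = fun t => N 0 x + ∫ s in (0 : ℝ)..t, -divergence K (V s) x from
      funext fun t => hN t x]
    exact continuous_const.add (intervalIntegral.continuous_primitive (hDii x) 0)
  have hdiv0 : ∀ t ∉ Ioc (0 : ℝ) 1, ∀ x, -divergence K (V t) x = 0 := fun t ht x => by
    simp [hV0 t ht, divergence]
  have hNle : ∀ t ≤ 0, N t = N 0 := fun t ht => by
    ext x
    rw [hN t x, intervalIntegral.integral_zero_ae, add_zero]
    refine Filter.Eventually.of_forall fun s hs => hdiv0 s (fun h => ?_) x
    rw [uIoc_of_ge ht] at hs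
    exact absurd h.1 hs.2.not_gt
  have hNge : ∀ t ≥ 1, N t = N 1 := fun t ht => by
    ext x
    rw [hN t x, hN 1 x, ← intervalIntegral.integral_add_adjacent_intervals (hDii x 0 1)
      (hDii x 1 t), intervalIntegral.integral_zero_ae (a := 1), add_zero]
    refine Filter.Eventually.of_forall fun s hs => hdiv0 s (fun h => ?_) x
    rw [uIoc_of_le ht] at hs
    exact absurd h.2 hs.1.not_ge
  have hNpos : ∀ t x, 0 < N t x := fun t x => by
    rcases le_total t 0 with h | h
    · rw [hNle t h]; exact hpos 0 (by simp) x
    rcases le_total 1 t with h' | h'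
    · rw [hNge t h']; exact hpos 1 (by simp) x
    · exact hpos t ⟨h, h'⟩ x
  set F : ℝ → ℝ≥0∞ := fun t => fluxAction K w (N t) (V t) with hF
  have hFm : Measurable F := measurable_fluxAction K w (fun x => (hNc x).measurable) hVm
  have hFI : ∫⁻ t, F t = ∫⁻ t in Icc (0 : ℝ) 1, F t := by
    refine (setLIntegral_eq_of_support_subset fun t ht => ?_).symm
    by_contra h
    exact ht (by simp [hF, hV0 t fun h' => h (Ioc_subset_Icc_self h'), fluxAction_zero])
  set I := ∫⁻ t in Icc (0 : ℝ) 1, F t with hI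
  -- the competitor obtained by averaging over time windows of length `δ`
  have key : ∀ δ : ℝ, 0 < δ → distD K w p a b μ₀ μ₁ ^ 2 ≤
      ENNReal.ofReal (a ^ 2 * (|H₀| + |H₁|) ^ 2) +
        ENNReal.ofReal (b ^ 2) * (ENNReal.ofReal (1 + δ) * I) := by
    intro δ hδ
    set A : ℝ → X → ℝ := fun t x => ∫ u in (0 : ℝ)..1, N (t + δ * u) x with hA
    set B : ℝ → X → X → ℝ := fun t x y => ∫ u in (0 : ℝ)..1, V (t + δ * u) x y with hB
    have hAc : ∀ x, Continuous fun t => A t x := fun x =>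
      continuous_average (fun _ _ => (hNc x).intervalIntegrable _ _) hδ
    have hBc : ∀ x y, Continuous fun t => B t x y := fun x y => continuous_average (hVii x y) hδ
    have hshift : ∀ t x y,
        Integrable (fun u => V (t + δ * u) x y) (volume.restrict (Ioc (0 : ℝ) 1)) :=
      fun t x y => (((hVi x y).comp_add_left t).comp_mul_left' hδ.ne').restrict
    have hNshift : ∀ t x, Continuous fun u => N (t + δ * u) x := fun t x =>
      (hNc x).comp (by fun_prop)
    have hAd : ∀ x t, HasDerivAt (fun t => A t x) (-divergence K (B t) x) t := fun x t => by
      have h := hasDerivAt_average (hDii x) (fun t => hN t x) hδ t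
      rw [intervalIntegral.integral_of_le zero_le_one, integral_neg,
        integral_divergence K (hshift t) x] at h
      simpa only [hA, hB, intervalIntegral.integral_of_le zero_le_one] using h
    have hApos : ∀ t x, 0 < A t x := fun t x =>
      intervalIntegral.intervalIntegral_pos_of_pos ((hNshift t x).intervalIntegrable _ _)
        (fun u => hNpos _ x) one_pos
    have haff : ∀ t : ℝ, HasDerivAt (fun t : ℝ => -δ + (1 + δ) * t) (1 + δ) t := fun t => by
      simpa using ((hasDerivAt_id t).const_mul (1 + δ)).const_add (-δ)
    have hνd : ∀ x t, HasDerivAt (fun t => A (-δ + (1 + δ) * t) x)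
        (-divergence K (fun y z => (1 + δ) * B (-δ + (1 + δ) * t) y z) x) t := fun x t => by
      have h := (hAd x (-δ + (1 + δ) * t)).comp t (haff t)
      have e : divergence K (fun y z => (1 + δ) * B (-δ + (1 + δ) * t) y z) x =
          (1 + δ) * divergence K (B (-δ + (1 + δ) * t)) x :=
        congrFun ((divergenceLinear K).map_smul (1 + δ) (B (-δ + (1 + δ) * t))) x
      refine h.congr_deriv ?_
      rw [e]
      ring
    have hUc : Continuous fun t : ℝ => fun y z => (1 + δ) * B (-δ + (1 + δ) * t) y z := by
      refine continuous_pi fun y => continuous_pi fun z => ?_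
      exact continuous_const.mul ((hBc y z).comp (by fun_prop))
    have hST : IsST K w p μ₀ μ₁ H₀ H₁ (fun t => A (-δ + (1 + δ) * t))
        fun t y z => (1 + δ) * B (-δ + (1 + δ) * t) y z :=
      { shift_left_nonneg := fun x => by rw [← hleft]; exact (hNpos 0 x).le
        shift_right_nonneg := fun x => by rw [← hright]; exact (hNpos 1 x).le
        mass_eq := hmass
        nonneg := fun t _ x => (hApos _ x).le
        contDiffOn := by
          refine contDiffOn_pi.2 fun x => ContDiff.contDiffOn ?_
          refine contDiff_one_iff_deriv.2 ⟨fun t => (hνd x t).differentiableAt, ?_⟩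
          rw [funext fun t => (hνd x t).deriv]
          simp only [divergence]
          refine (continuous_const.mul (continuous_finsetSum _ fun y _ => ?_)).neg
          have h1 := (continuous_pi_iff.1 ((continuous_pi_iff.1 hUc) x)) y
          have h2 := (continuous_pi_iff.1 ((continuous_pi_iff.1 hUc) y)) x
          exact (h1.sub h2).mul continuous_const
        measurable_flux := hUc.measurable
        continuity := Filter.Eventually.of_forall fun t x => hνd x t
        left := fun x => by
          rw [← hleft]
          have : ∫ u in (0 : ℝ)..1, N (-δ + (1 + δ) * 0 + δ * u) x = ∫ u in (0 : ℝ)..1, N 0 x := by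
            refine intervalIntegral.integral_congr fun u hu => ?_
            rw [uIcc_of_le zero_le_one] at hu
            rw [hNle _ (by nlinarith [hu.2])]
          simpa [hA] using this
        right := fun x => by
          rw [← hright]
          have : ∫ u in (0 : ℝ)..1, N (-δ + (1 + δ) * 1 + δ * u) x = ∫ u in (0 : ℝ)..1, N 1 x := by
            refine intervalIntegral.integral_congr fun u hu => ?_
            rw [uIcc_of_le zero_le_one] at hu
            rw [hNge _ (by nlinarith [hu.1])]
          simpa [hA] using this }
    have hJ : ∀ t, fluxAction K w (A t) (B t) ≤ ∫⁻ u in Ioc (0 : ℝ) 1, F (t + δ * u) := by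
      intro t
      have hposI := hApos t
      simp only [hA, intervalIntegral.integral_of_le zero_le_one] at hposI
      have h := fluxAction_integral_le (P := volume.restrict (Ioc (0 : ℝ) 1)) K w
        (N := fun u => N (t + δ * u)) (V := fun u => V (t + δ * u))
        (fun x => (hNshift t x).measurable)
        (fun x y => (hVm x y).comp (by fun_prop))
        (fun x => ((hNshift t x).integrableOn_Icc).mono_set Ioc_subset_Icc_self)
        (hshift t) (fun u x => (hNpos _ x).le) hposI
      simpa only [hA, hB, intervalIntegral.integral_of_le zero_le_one] using h
    have hflux : ∫⁻ t in Icc (0 : ℝ) 1, fluxAction K w (A (-δ + (1 + δ) * t))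
        (fun y z => (1 + δ) * B (-δ + (1 + δ) * t) y z) ≤ ENNReal.ofReal (1 + δ) * I := by
      have hm : Measurable fun t => fluxAction K w (A t) (B t) :=
        measurable_fluxAction K w (fun x => (hAc x).measurable) fun x y => (hBc x y).measurable
      have hκ : 0 < 1 + δ := by linarith
      have hF2 : Measurable fun z : ℝ × ℝ => F (z.1 + δ * z.2) := hFm.comp (by fun_prop)
      have hFubini : ∫⁻ t, fluxAction K w (A t) (B t) ≤ I :=
        calc ∫⁻ t, fluxAction K w (A t) (B t)
            ≤ ∫⁻ t, ∫⁻ u in Ioc (0 : ℝ) 1, F (t + δ * u) := lintegral_mono hJ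
          _ = ∫⁻ u in Ioc (0 : ℝ) 1, ∫⁻ t, F (t + δ * u) :=
            lintegral_lintegral_swap hF2.aemeasurable
          _ = I := by
            simp_rw [lintegral_add_right_eq_self F, hFI]
            simp
      calc _ ≤ ∫⁻ t, fluxAction K w (A (-δ + (1 + δ) * t))
            (fun y z => (1 + δ) * B (-δ + (1 + δ) * t) y z) := setLIntegral_le_lintegral _ _
        _ = ENNReal.ofReal ((1 + δ) ^ 2) *
            ∫⁻ t, fluxAction K w (A (-δ + (1 + δ) * t)) (B (-δ + (1 + δ) * t)) := by
          simp_rw [fluxAction_mul K w _ _ hκ]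
          exact lintegral_const_mul _ (hm.comp (by fun_prop))
        _ = ENNReal.ofReal (1 + δ) * ∫⁻ t, fluxAction K w (A t) (B t) := by
          rw [lintegral_comp_add_mul hm hκ, ← mul_assoc,
            ← ENNReal.ofReal_mul (sq_nonneg _)]
          congr 2
          field_simp
        _ ≤ _ := by gcongr
    refine (distD_sq_le hST).trans ?_
    unfold shiftTransportAction
    gcongr
  have hlim : Filter.Tendsto (fun δ : ℝ => ENNReal.ofReal (a ^ 2 * (|H₀| + |H₁|) ^ 2) +
      ENNReal.ofReal (b ^ 2) * (ENNReal.ofReal (1 + δ) * I)) (nhdsWithin 0 (Ioi 0))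
      (nhds (ENNReal.ofReal (a ^ 2 * (|H₀| + |H₁|) ^ 2) + ENNReal.ofReal (b ^ 2) * I)) := by
    have h1 : Filter.Tendsto (fun δ : ℝ => ENNReal.ofReal (1 + δ)) (nhdsWithin 0 (Ioi 0))
        (nhds 1) := by
      have : Continuous fun δ : ℝ => ENNReal.ofReal (1 + δ) :=
        ENNReal.continuous_ofReal.comp (by fun_prop)
      simpa using (this.tendsto 0).mono_left nhdsWithin_le_nhds
    have h2 := ENNReal.Tendsto.mul_const (b := I) h1 (Or.inl one_ne_zero)
    rw [one_mul] at h2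
    exact tendsto_const_nhds.add
      (ENNReal.Tendsto.const_mul h2 (Or.inr ENNReal.ofReal_ne_top))
  exact ge_of_tendsto hlim (Filter.eventually_of_mem self_mem_nhdsWithin fun δ hδ => key δ hδ)

end Averaging

/-! ### Solutions of the continuity equation in integral form -/

section IntegralForm

variable {X : Type*} [Fintype X]

/-- The continuity equation with source in integral form, for a curve defined and continuous on the
whole real line (extended by constants outside `[0,1]`, so that measurability is available). -/
structure IsIntegralCE (K : Matrix X X ℝ) (p μ₀ μ₁ : X → ℝ)
    (μ : ℝ → X → ℝ) (ψ : ℝ → X → ℝ) (h : ℝ → ℝ) : Prop where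
  continuous : ∀ x, Continuous fun t => μ t x
  nonneg : ∀ t x, 0 ≤ μ t x
  measurable_potential : Measurable ψ
  measurable_source : Measurable h
  integrable : ∀ x, IntervalIntegrable (fun t => h t * p x -
    divergence K (fun y z => mobility (μ t) y z * grad (ψ t) y z) x) volume 0 1
  primitive : ∀ t ∈ Icc (0 : ℝ) 1, ∀ x, μ t x = μ₀ x + ∫ s in (0 : ℝ)..t, (h s * p x -
    divergence K (fun y z => mobility (μ s) y z * grad (ψ s) y z) x)
  right : μ 1 = μ₁

lemma absolutelyContinuousOnInterval_apply {f : ℝ → X → ℝ} {s t : ℝ}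
    (hf : AbsolutelyContinuousOnInterval f s t) (x : X) :
    AbsolutelyContinuousOnInterval (fun u => f u x) s t := by
  rw [absolutelyContinuousOnInterval_iff] at hf ⊢
  intro ε hε
  obtain ⟨δ, hδ, h⟩ := hf ε hε
  exact ⟨δ, hδ, fun E hE hEδ => (Finset.sum_le_sum fun i _ => dist_le_pi_dist _ _ x).trans_lt
    (h E hE hEδ)⟩

lemma IsCE.exists_isIntegralCE {K : Matrix X X ℝ} {p μ₀ μ₁ : X → ℝ} {μ : ℝ → X → ℝ}
    {ψ : ℝ → X → ℝ} {h : ℝ → ℝ} (hCE : IsCE K p μ₀ μ₁ μ ψ h) (w : X → ℝ) (a b : ℝ) :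
    ∃ m, IsIntegralCE K p μ₀ μ₁ m ψ h ∧
      potentialAction K w a b m ψ h = potentialAction K w a b μ ψ h := by
  have hproj : ∀ t : ℝ, max 0 (min 1 t) ∈ Icc (0 : ℝ) 1 := fun t =>
    ⟨le_max_left _ _, max_le zero_le_one (min_le_left _ _)⟩
  have hm : ∀ t ∈ Icc (0 : ℝ) 1, μ (max 0 (min 1 t)) = μ t := fun t ht => by
    rw [min_eq_right ht.2, max_eq_right ht.1]
  have hac := fun x => absolutelyContinuousOnInterval_apply hCE.ac x
  set D : ℝ → X → ℝ := fun t x => h t * p x - divergence K (fun y z =>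
    mobility (μ (max 0 (min 1 t))) y z * grad (ψ t) y z) x with hD
  have hder : ∀ x, ∀ᵐ t ∂(volume.restrict (Icc (0 : ℝ) 1)), deriv (fun s => μ s x) t = D t x := by
    intro x
    filter_upwards [hCE.continuity, ae_restrict_mem measurableSet_Icc] with t ht ht1
    rw [(ht x).deriv, hD]
    simp only [hm t ht1]
  refine ⟨fun t => μ (max 0 (min 1 t)), ⟨fun x => ?_, fun t x => hCE.nonneg _ (hproj t) x,
    hCE.measurable_potential, hCE.measurable_source, fun x => ?_, fun t ht x => ?_, ?_⟩, ?_⟩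
  · have hc := (hac x).continuousOn
    rw [uIcc_of_le zero_le_one] at hc
    exact hc.comp_continuous (f := fun t : ℝ => max 0 (min 1 t)) (by fun_prop) hproj
  · refine (hac x).intervalIntegrable_deriv.congr_ae ?_
    rw [uIoc_of_le zero_le_one]
    exact ae_restrict_of_ae_restrict_of_subset Ioc_subset_Icc_self (hder x)
  · have h1 := ((hac x).mono (c := 0) (d := t)
      (uIcc_subset_uIcc_left (by rwa [uIcc_of_le zero_le_one]))).integral_deriv_eq_sub
    have h2 : ∫ s in (0 : ℝ)..t, D s x = ∫ s in (0 : ℝ)..t, deriv (fun s => μ s x) s := by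
      rw [intervalIntegral.integral_of_le ht.1, intervalIntegral.integral_of_le ht.1]
      refine integral_congr_ae ?_
      have hsub : Ioc 0 t ⊆ Icc (0 : ℝ) 1 := fun s hs => ⟨hs.1.le, hs.2.trans ht.2⟩
      filter_upwards [ae_restrict_of_ae_restrict_of_subset hsub (hder x)] with s hs
      exact hs.symm
    rw [h2, h1, hm t ht, hCE.left]
    ring
  · rw [hm 1 (by simp), hCE.right]
  · unfold potentialAction
    congr 2
    exact setLIntegral_congr_fun measurableSet_Icc fun t ht => by simp only [hm t ht]

namespace IsIntegralCE

variable {K : Matrix X X ℝ} {w p μ₀ μ₁ : X → ℝ} {a b : ℝ} {μ : ℝ → X → ℝ} {ψ : ℝ → X → ℝ}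
  {h : ℝ → ℝ}

lemma measurable_mobility (hCE : IsIntegralCE K p μ₀ μ₁ μ ψ h) (x y : X) :
    Measurable fun t => mobility (μ t) x y :=
  measurable_logMean.comp ((hCE.continuous x).measurable.prodMk (hCE.continuous y).measurable)

lemma measurable_grad (hCE : IsIntegralCE K p μ₀ μ₁ μ ψ h) (x y : X) :
    Measurable fun t => grad (ψ t) x y :=
  (measurable_pi_iff.1 hCE.measurable_potential y).sub
    (measurable_pi_iff.1 hCE.measurable_potential x)

lemma measurable_normSq (hCE : IsIntegralCE K p μ₀ μ₁ μ ψ h) (w : X → ℝ) :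
    Measurable fun t => normSq K w (μ t) (grad (ψ t)) := by
  refine Measurable.const_mul (Finset.measurable_fun_sum _ fun x _ =>
    Finset.measurable_fun_sum _ fun y _ => ?_) _
  exact ((((hCE.measurable_grad x y).pow_const 2).mul (hCE.measurable_mobility x y)).mul_const
    _).mul_const _

lemma normSq_nonneg (hCE : IsIntegralCE K p μ₀ μ₁ μ ψ h) (hKw : ∀ x y, 0 ≤ K x y * w x) (t : ℝ) :
    0 ≤ normSq K w (μ t) (grad (ψ t)) := by
  refine mul_nonneg (by norm_num) (Finset.sum_nonneg fun x _ => Finset.sum_nonneg fun y _ => ?_)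
  rw [mul_assoc]
  exact mul_nonneg (mul_nonneg (sq_nonneg _)
    (logMean_nonneg (hCE.nonneg t x) (hCE.nonneg t y))) (hKw x y)

/-- A curve of finite action has a square-integrable source and an integrable kinetic energy, and
the action is the real number one expects. -/
lemma of_action_ne_top (hCE : IsIntegralCE K p μ₀ μ₁ μ ψ h) (hKw : ∀ x y, 0 ≤ K x y * w x)
    (ha : 0 < a) (hb : 0 < b) (hfin : potentialAction K w a b μ ψ h ≠ ∞) :
    IntervalIntegrable h volume 0 1 ∧ IntervalIntegrable (fun t => h t ^ 2) volume 0 1 ∧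
    IntervalIntegrable (fun t => normSq K w (μ t) (grad (ψ t))) volume 0 1 ∧
    potentialAction K w a b μ ψ h = ENNReal.ofReal (a ^ 2 * (∫ t in (0 : ℝ)..1, h t ^ 2) +
      b ^ 2 * ∫ t in (0 : ℝ)..1, normSq K w (μ t) (grad (ψ t))) := by
  have hE0 := hCE.normSq_nonneg hKw
  unfold potentialAction at hfin
  rw [ENNReal.add_ne_top] at hfin
  have h1 : ∫⁻ t in Icc (0 : ℝ) 1, ENNReal.ofReal (h t ^ 2) ≠ ∞ := fun htop => by
    rw [htop, ENNReal.mul_top (by simp [ha.ne'])] at hfin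
    exact hfin.1 rfl
  have h2 : ∫⁻ t in Icc (0 : ℝ) 1, ENNReal.ofReal (normSq K w (μ t) (grad (ψ t))) ≠ ∞ :=
    fun htop => by
      rw [htop, ENNReal.mul_top (by simp [hb.ne'])] at hfin
      exact hfin.2 rfl
  have hm1 : Measurable fun t => h t ^ 2 := hCE.measurable_source.pow_const 2
  have hi1 : IntegrableOn (fun t => h t ^ 2) (Icc (0 : ℝ) 1) :=
    (lintegral_ofReal_ne_top_iff_integrable hm1.aestronglyMeasurable
      (Filter.Eventually.of_forall fun t => sq_nonneg (h t))).1 h1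
  have hi2 : IntegrableOn (fun t => normSq K w (μ t) (grad (ψ t))) (Icc (0 : ℝ) 1) :=
    (lintegral_ofReal_ne_top_iff_integrable (hCE.measurable_normSq w).aestronglyMeasurable
      (Filter.Eventually.of_forall hE0)).1 h2
  have hi0 : IntegrableOn h (Icc (0 : ℝ) 1) := by
    refine Integrable.mono' (hi1.add (integrable_const (1 : ℝ)))
      hCE.measurable_source.aestronglyMeasurable (Filter.Eventually.of_forall fun t => ?_)
    simp only [Real.norm_eq_abs, Pi.add_apply]
    nlinarith [sq_abs (h t), sq_nonneg (|h t| - 1), abs_nonneg (h t)]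
  refine ⟨(intervalIntegrable_iff_integrableOn_Icc_of_le zero_le_one).2 hi0,
    (intervalIntegrable_iff_integrableOn_Icc_of_le zero_le_one).2 hi1,
    (intervalIntegrable_iff_integrableOn_Icc_of_le zero_le_one).2 hi2, ?_⟩
  have e1 := ofReal_integral_eq_lintegral_ofReal hi1
    (Filter.Eventually.of_forall fun t => sq_nonneg (h t))
  have e2 := ofReal_integral_eq_lintegral_ofReal hi2 (Filter.Eventually.of_forall hE0)
  have n1 : 0 ≤ ∫ t in Icc (0 : ℝ) 1, h t ^ 2 := integral_nonneg fun t => sq_nonneg (h t)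
  have n2 : 0 ≤ ∫ t in Icc (0 : ℝ) 1, normSq K w (μ t) (grad (ψ t)) := integral_nonneg hE0
  rw [potentialAction, ← e1, ← e2, ← ENNReal.ofReal_mul (sq_nonneg a),
    ← ENNReal.ofReal_mul (sq_nonneg b), ← ENNReal.ofReal_add (by positivity) (by positivity),
    intervalIntegral.integral_of_le zero_le_one, intervalIntegral.integral_of_le zero_le_one,
    integral_Icc_eq_integral_Ioc, integral_Icc_eq_integral_Ioc]

lemma intervalIntegrable_sqrt_normSq
    (hCE : IsIntegralCE K p μ₀ μ₁ μ ψ h) (hKw : ∀ x y, 0 ≤ K x y * w x)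
    (hE : IntervalIntegrable (fun t => normSq K w (μ t) (grad (ψ t))) volume 0 1) :
    IntervalIntegrable (fun t => √(normSq K w (μ t) (grad (ψ t)))) volume 0 1 := by
  have hE0 := hCE.normSq_nonneg hKw
  rw [intervalIntegrable_iff_integrableOn_Ioc_of_le zero_le_one] at hE ⊢
  refine Integrable.mono' (hE.add (integrable_const (1 : ℝ)))
    (hCE.measurable_normSq w).sqrt.aestronglyMeasurable (Filter.Eventually.of_forall fun t => ?_)
  simp only [Real.norm_eq_abs, Pi.add_apply, abs_of_nonneg (Real.sqrt_nonneg _)]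
  nlinarith [Real.sq_sqrt (hE0 t), sq_nonneg (√(normSq K w (μ t) (grad (ψ t))) - 1),
    Real.sqrt_nonneg (normSq K w (μ t) (grad (ψ t)))]

/-- The divergence does not change the total mass. -/
lemma sum_mul_eq (hCE : IsIntegralCE K p μ₀ μ₁ μ ψ h) (hrev : ∀ x y, K x y * w x = K y x * w y)
    (hpm : ∑ x, w x * p x = 1) {t : ℝ} (ht : t ∈ Icc (0 : ℝ) 1) :
    ∑ x, w x * μ t x = ∑ x, w x * μ₀ x + ∫ s in (0 : ℝ)..t, h s := by
  have hi : ∀ x ∈ Finset.univ, IntervalIntegrable (fun s => w x * (h s * p x -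
      divergence K (fun y z => mobility (μ s) y z * grad (ψ s) y z) x)) volume 0 t := fun x _ =>
    ((hCE.integrable x).mono_set (uIcc_subset_uIcc_left
      (by rwa [uIcc_of_le zero_le_one]))).const_mul _
  have h1 : ∀ x, w x * μ t x = w x * μ₀ x + ∫ s in (0 : ℝ)..t, w x * (h s * p x -
      divergence K (fun y z => mobility (μ s) y z * grad (ψ s) y z) x) := fun x => by
    rw [intervalIntegral.integral_const_mul, hCE.primitive t ht x]
    ring
  rw [Finset.sum_congr rfl fun x _ => h1 x, Finset.sum_add_distrib,
    ← intervalIntegral.integral_finsetSum hi]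
  congr 2
  ext s
  have e : ∀ x, w x * (h s * p x -
      divergence K (fun y z => mobility (μ s) y z * grad (ψ s) y z) x) = h s * (w x * p x) -
      w x * divergence K (fun y z => mobility (μ s) y z * grad (ψ s) y z) x := fun x => by ring
  simp_rw [e]
  rw [Finset.sum_sub_distrib, ← Finset.mul_sum, hpm, sum_mul_divergence hrev]
  ring

end IsIntegralCE

end IntegralForm

/-! ### The flux of a potential -/

section Flux

variable {X : Type*} [Fintype X]

open Classical in
/-- The flux `μ̂ ∇ψ`, set to zero on the pairs that are not edges of `K`: there it carries no action
and the kinetic energy does not control it. -/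
noncomputable def edgeFlux (K : Matrix X X ℝ) (ν φ : X → ℝ) (x y : X) : ℝ :=
  if K x y = 0 then 0 else mobility ν x y * grad φ x y

variable {K : Matrix X X ℝ} {w : X → ℝ} {M : ℝ} {ν φ : X → ℝ}

lemma divergence_edgeFlux (hw : ∀ x, 0 < w x) (hrev : ∀ x y, K x y * w x = K y x * w y)
    (ν φ : X → ℝ) (x : X) :
    divergence K (edgeFlux K ν φ) x =
      divergence K (fun y z => mobility ν y z * grad φ y z) x := by
  unfold divergence
  congr 1
  refine Finset.sum_congr rfl fun y _ => ?_
  by_cases hxy : K x y = 0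
  · simp [hxy]
  · have hyx : K y x ≠ 0 := fun h0 => by
      have := hrev x y
      rw [h0, zero_mul] at this
      exact (mul_ne_zero hxy (hw x).ne') this
    simp [edgeFlux, hxy, hyx]

/-- The flux is controlled by the square root of the kinetic energy. -/
lemma abs_edgeFlux_le (hw : ∀ x, 0 < w x) (hK : ∀ x y, 0 ≤ K x y) (hν : ∀ x, 0 ≤ ν x)
    (hνM : ∀ x, ν x ≤ M) (x y : X) :
    |edgeFlux K ν φ x y| ≤ √(2 * M / (K x y * w x)) * √(normSq K w ν (grad φ)) := by
  have hM : 0 ≤ M := (hν x).trans (hνM x)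
  have hKw : ∀ x y, 0 ≤ K x y * w x := fun x y => mul_nonneg (hK x y) (hw x).le
  by_cases hxy : K x y = 0
  · simp [edgeFlux, hxy]
  have hpos : 0 < K x y * w x := mul_pos ((hK x y).lt_of_ne' hxy) (hw x)
  have hθ := logMean_nonneg (hν x) (hν y)
  have hθM := logMean_le (hν x) (hν y) (hνM x) (hνM y)
  have hterm : ∀ x y, 0 ≤ grad φ x y ^ 2 * mobility ν x y * K x y * w x := fun x y => by
    rw [mul_assoc]
    exact mul_nonneg (mul_nonneg (sq_nonneg _) (logMean_nonneg (hν x) (hν y))) (hKw x y)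
  have hle : grad φ x y ^ 2 * mobility ν x y * (K x y * w x) ≤ 2 * normSq K w ν (grad φ) := by
    have h1 := Finset.single_le_sum (fun y _ => hterm x y) (Finset.mem_univ y)
    have h2 := Finset.single_le_sum (
      f := fun x => ∑ y, grad φ x y ^ 2 * mobility ν x y * K x y * w x)
      (fun x _ => Finset.sum_nonneg fun y _ => hterm x y) (Finset.mem_univ x)
    have h3 : 2 * normSq K w ν (grad φ) =
      ∑ x, ∑ y, grad φ x y ^ 2 * mobility ν x y * K x y * w x := by
      rw [normSq]; ring
    rw [h3, ← mul_assoc]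
    exact h1.trans h2
  rw [← Real.sqrt_mul (by positivity)]
  refine Real.abs_le_sqrt ?_
  simp only [edgeFlux, hxy, if_false]
  have hm : mobility ν x y = logMean (ν x) (ν y) := rfl
  rw [div_mul_eq_mul_div, le_div_iff₀ hpos]
  calc (mobility ν x y * grad φ x y) ^ 2 * (K x y * w x)
      = mobility ν x y * (grad φ x y ^ 2 * mobility ν x y * (K x y * w x)) := by ring
    _ ≤ M * (2 * normSq K w ν (grad φ)) := by
        refine mul_le_mul (hm ▸ hθM) hle ?_ hM
        exact mul_nonneg (mul_nonneg (sq_nonneg _) (hm ▸ hθ)) hpos.le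
    _ = _ := by ring

lemma exists_abs_divergence_edgeFlux_le (hw : ∀ x, 0 < w x) (hK : ∀ x y, 0 ≤ K x y) (M : ℝ)
    (x : X) : ∃ L, 0 ≤ L ∧ ∀ ν φ : X → ℝ, (∀ x, 0 ≤ ν x) → (∀ x, ν x ≤ M) →
      |divergence K (edgeFlux K ν φ) x| ≤ L * √(normSq K w ν (grad φ)) := by
  refine ⟨1 / 2 * ∑ y, (√(2 * M / (K x y * w x)) + √(2 * M / (K y x * w y))) * K x y,
    mul_nonneg (by norm_num) (Finset.sum_nonneg fun y _ => mul_nonneg (by positivity) (hK x y)),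
    fun ν φ hν hνM => ?_⟩
  rw [divergence, abs_mul, abs_of_nonneg (by norm_num : (0 : ℝ) ≤ 1 / 2), mul_assoc,
    Finset.sum_mul]
  refine mul_le_mul_of_nonneg_left ((Finset.abs_sum_le_sum_abs _ _).trans
    (Finset.sum_le_sum fun y _ => ?_)) (by norm_num)
  rw [abs_mul, abs_of_nonneg (hK x y), mul_right_comm]
  refine mul_le_mul_of_nonneg_right ?_ (hK x y)
  rw [add_mul]
  exact (abs_sub _ _).trans (add_le_add (abs_edgeFlux_le hw hK hν hνM x y)
    (abs_edgeFlux_le hw hK hν hνM y x))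

/-- Shifting a density upwards by `ρ p` divides the action of a given flux by `1 + c ρ`. -/
lemma fluxAction_shift_le (hw : ∀ x, 0 < w x) (hK : ∀ x y, 0 ≤ K x y) (hν : ∀ x, 0 ≤ ν x)
    (hνM : ∀ x, ν x ≤ M) (hM : 0 < M) {p : X → ℝ} {c ρ : ℝ} (hc : 0 < c)
    (hp : ∀ x, c * M ≤ p x) (hρ : 0 < ρ) :
    fluxAction K w (fun x => ν x + ρ * p x) (edgeFlux K ν φ) ≤
      ENNReal.ofReal (normSq K w ν (grad φ) / (1 + c * ρ)) := by
  have hKw : ∀ x y, 0 ≤ K x y * w x := fun x y => mul_nonneg (hK x y) (hw x).le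
  have hsh : ∀ x, ρ * (c * M) ≤ ν x + ρ * p x := fun x => by
    have := mul_le_mul_of_nonneg_left (hp x) hρ.le
    linarith [hν x]
  have hG : ∀ x y, 0 < logMean (ν x + ρ * p x) (ν y + ρ * p y) := fun x y =>
    (by positivity : 0 < ρ * (c * M)).trans_le
      (le_logMean (by positivity) (hsh x) (hsh y))
  refine (fluxAction_le_of_le_logMean hG (fun _ _ => le_rfl) hKw).trans
    (ENNReal.ofReal_le_ofReal ?_)
  rw [normSq, mul_div_assoc, Finset.sum_div]
  simp_rw [Finset.sum_div]
  refine mul_le_mul_of_nonneg_left (Finset.sum_le_sum fun x _ => Finset.sum_le_sum fun y _ => ?_)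
    (by norm_num)
  have hpos : 0 < 1 + c * ρ := by positivity
  have hgain := mul_logMean_le_logMean_add (hν x) (hν y) (hνM x) (hνM y) hM hc (hp x) (hp y) hρ
  have hθ := logMean_nonneg (hν x) (hν y)
  have hrw : grad φ x y ^ 2 * mobility ν x y * K x y * w x / (1 + c * ρ) =
      grad φ x y ^ 2 * mobility ν x y / (1 + c * ρ) * (K x y * w x) := by ring
  rw [hrw]
  refine mul_le_mul_of_nonneg_right ?_ (hKw x y)
  by_cases hxy : K x y = 0
  · simp only [edgeFlux, hxy, if_true]
    rw [zero_pow two_ne_zero, zero_div]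
    exact div_nonneg (mul_nonneg (sq_nonneg _) hθ) hpos.le
  · simp only [edgeFlux, hxy, if_false, mobility]
    rw [div_le_div_iff₀ (hG x y) hpos]
    calc (logMean (ν x) (ν y) * grad φ x y) ^ 2 * (1 + c * ρ)
        = grad φ x y ^ 2 * logMean (ν x) (ν y) * (logMean (ν x) (ν y) * (1 + c * ρ)) := by ring
      _ ≤ _ := mul_le_mul_of_nonneg_left hgain (mul_nonneg (sq_nonneg _) hθ)

/-! ### The shifted competitor -/

lemma intervalIntegrable_div_shift {E h : ℝ → ℝ} (hh : IntervalIntegrable h volume 0 1)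
    (hE : IntervalIntegrable E volume 0 1) {c R₀ ε : ℝ} (hc : 0 < c)
    (hR₀ : ∀ t ∈ Icc (0 : ℝ) 1, ∫ s in (0 : ℝ)..t, h s ≤ R₀) (hε : 0 < ε) :
    IntervalIntegrable (fun t => E t / (1 + c * ((R₀ - ∫ s in (0 : ℝ)..t, h s) + ε)))
      volume 0 1 := by
  have h1 := intervalIntegral.continuousOn_primitive_interval' hh (a := 0) (by simp)
  rw [uIcc_of_le zero_le_one] at h1
  have hcont : ContinuousOn (fun t => (1 + c * ((R₀ - ∫ s in (0 : ℝ)..t, h s) + ε))⁻¹)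
      (Icc (0 : ℝ) 1) := by
    refine ContinuousOn.inv₀ (continuousOn_const.add (continuousOn_const.mul
      ((continuousOn_const.sub h1).add continuousOn_const))) fun t ht => ?_
    have := sub_nonneg.2 (hR₀ t ht)
    positivity
  rw [intervalIntegrable_iff_integrableOn_Icc_of_le zero_le_one] at hE ⊢
  simp_rw [div_eq_mul_inv]
  exact hE.mul_continuousOn hcont isCompact_Icc

/-- The competitor for `distD` built from a solution of the continuity equation with source: keep
the flux, and put all the source into the two shifts. At time `t` it exceeds the given curve by
`(R₀ + ε - ∫₀ᵗ h) p`. -/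
theorem IsIntegralCE.distD_sq_le {p μ₀ μ₁ : X → ℝ} {a b : ℝ} {μ : ℝ → X → ℝ} {ψ : ℝ → X → ℝ}
    {h : ℝ → ℝ} (hCE : IsIntegralCE K p μ₀ μ₁ μ ψ h)
    (hw : ∀ x, 0 < w x) (hK : ∀ x y, 0 ≤ K x y) (hrev : ∀ x y, K x y * w x = K y x * w y)
    (hpm : ∑ x, w x * p x = 1) (hμ₀ : ∀ x, 0 ≤ μ₀ x) (hμ₁ : ∀ x, 0 ≤ μ₁ x)
    {c : ℝ} (hM : 0 < M) (hμM : ∀ t ∈ Icc (0 : ℝ) 1, ∀ x, μ t x ≤ M)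
    (hc : 0 < c) (hp : ∀ x, c * M ≤ p x)
    (hh : IntervalIntegrable h volume 0 1)
    (hE : IntervalIntegrable (fun t => normSq K w (μ t) (grad (ψ t))) volume 0 1)
    {R₀ : ℝ} (hR₀ : ∀ t ∈ Icc (0 : ℝ) 1, ∫ s in (0 : ℝ)..t, h s ≤ R₀) {ε : ℝ} (hε : 0 < ε) :
    distD K w p a b μ₀ μ₁ ^ 2 ≤
      ENNReal.ofReal (a ^ 2 * (R₀ + (R₀ - ∫ t in (0 : ℝ)..1, h t) + 2 * ε) ^ 2 +
        b ^ 2 * ∫ t in (0 : ℝ)..1, normSq K w (μ t) (grad (ψ t)) /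
          (1 + c * ((R₀ - ∫ s in (0 : ℝ)..t, h s) + ε))) := by
  have hKw : ∀ x y, 0 ≤ K x y * w x := fun x y => mul_nonneg (hK x y) (hw x).le
  have hE0 := hCE.normSq_nonneg hKw
  have hp0 : ∀ x, 0 < p x := fun x => (by positivity : 0 < c * M).trans_le (hp x)
  have hEs := (intervalIntegrable_iff_integrableOn_Ioc_of_le zero_le_one).1
    (hCE.intervalIntegrable_sqrt_normSq hKw hE)
  set V : ℝ → X → X → ℝ := (Ioc (0 : ℝ) 1).indicator fun t => edgeFlux K (μ t) (ψ t) with hV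
  have hVapp : ∀ x y, (fun t => V t x y) =
      (Ioc (0 : ℝ) 1).indicator fun t => edgeFlux K (μ t) (ψ t) x y := fun x y => by
    ext t
    by_cases ht : t ∈ Ioc (0 : ℝ) 1
    · simp only [hV, indicator_of_mem ht]
    · simp only [hV, indicator_of_notMem ht, Pi.zero_apply]
  have hfm : ∀ x y, Measurable fun t => edgeFlux K (μ t) (ψ t) x y := fun x y => by
    unfold edgeFlux
    split_ifs
    · exact measurable_const
    · exact (hCE.measurable_mobility x y).mul (hCE.measurable_grad x y)
  have hVi : ∀ x y, Integrable fun t => V t x y := fun x y => by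
    rw [hVapp, integrable_indicator_iff measurableSet_Ioc]
    refine Integrable.mono' (hEs.const_mul √(2 * M / (K x y * w x))) (hfm x y).aestronglyMeasurable
      ?_
    filter_upwards [ae_restrict_mem measurableSet_Ioc] with t ht
    exact abs_edgeFlux_le hw hK (hCE.nonneg t) (hμM t (Ioc_subset_Icc_self ht)) x y
  set N : ℝ → X → ℝ := fun t x => (μ₀ x + (R₀ + ε) * p x) +
    ∫ s in (0 : ℝ)..t, -divergence K (V s) x with hN
  have hN0 : ∀ x, N 0 x = μ₀ x + (R₀ + ε) * p x := fun x => by simp [hN]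
  have hNt : ∀ t ∈ Icc (0 : ℝ) 1, ∀ x,
      N t x = μ t x + ((R₀ - ∫ s in (0 : ℝ)..t, h s) + ε) * p x := fun t ht x => by
    have hsub : uIcc (0 : ℝ) t ⊆ uIcc 0 1 := uIcc_subset_uIcc_left (by rwa [uIcc_of_le zero_le_one])
    have e : ∫ s in (0 : ℝ)..t, -divergence K (V s) x =
        (∫ s in (0 : ℝ)..t, (h s * p x -
          divergence K (fun y z => mobility (μ s) y z * grad (ψ s) y z) x)) -
        ∫ s in (0 : ℝ)..t, h s * p x := by
      rw [← intervalIntegral.integral_sub ((hCE.integrable x).mono_set hsub)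
        ((hh.mono_set hsub).mul_const _)]
      refine intervalIntegral.integral_congr_ae (Filter.Eventually.of_forall fun s hs => ?_)
      rw [uIoc_of_le ht.1] at hs
      have hs' : s ∈ Ioc (0 : ℝ) 1 := ⟨hs.1, hs.2.trans ht.2⟩
      simp only [hV, indicator_of_mem hs', divergence_edgeFlux hw hrev]
      ring
    rw [intervalIntegral.integral_mul_const] at e
    simp only [hN]
    rw [e, hCE.primitive t ht x]
    ring
  have hr1 : 0 ≤ R₀ - ∫ t in (0 : ℝ)..1, h t := sub_nonneg.2 (hR₀ 1 (by simp))
  have hr0 : 0 ≤ R₀ := by simpa using hR₀ 0 (by simp)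
  have hρ : ∀ t ∈ Icc (0 : ℝ) 1, 0 < (R₀ - ∫ s in (0 : ℝ)..t, h s) + ε := fun t ht =>
    add_pos_of_nonneg_of_pos (sub_nonneg.2 (hR₀ t ht)) hε
  have hmass : mass w μ₀ + (R₀ + ε) = mass w μ₁ + ((R₀ - ∫ t in (0 : ℝ)..1, h t) + ε) := by
    have := hCE.sum_mul_eq hrev hpm (t := 1) (by simp)
    rw [hCE.right] at this
    rw [mass_of_nonneg hμ₀, mass_of_nonneg hμ₁, this]
    ring
  refine (distD_sq_le_of_primitive (V := V) (N := N) (a := a) (b := b) hmass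
    (fun x y => by rw [hVapp]; exact (hfm x y).indicator measurableSet_Ioc) hVi
    (fun t ht => by simp only [hV, indicator_of_notMem ht])
    (fun t x => by rw [hN0]) (fun t ht x => ?_) hN0 (fun x => ?_)).trans ?_
  · rw [hNt t ht x]
    exact add_pos_of_nonneg_of_pos (hCE.nonneg t x) (mul_pos (hρ t ht) (hp0 x))
  · rw [hNt 1 (by simp), hCE.right]
  · have habs : |R₀ + ε| + |(R₀ - ∫ t in (0 : ℝ)..1, h t) + ε| =
        R₀ + (R₀ - ∫ t in (0 : ℝ)..1, h t) + 2 * ε := by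
      rw [abs_of_nonneg (by linarith), abs_of_nonneg (by linarith)]
      ring
    have hEnn : ∀ t ∈ Icc (0 : ℝ) 1, 0 ≤ normSq K w (μ t) (grad (ψ t)) /
        (1 + c * ((R₀ - ∫ s in (0 : ℝ)..t, h s) + ε)) := fun t ht => by
      have := hρ t ht
      exact div_nonneg (hE0 t) (by positivity)
    have hint := (intervalIntegrable_iff_integrableOn_Icc_of_le zero_le_one).1
      (intervalIntegrable_div_shift hh hE hc hR₀ hε)
    have hflux : ∫⁻ t in Icc (0 : ℝ) 1, fluxAction K w (N t) (V t) ≤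
        ENNReal.ofReal (∫ t in (0 : ℝ)..1, normSq K w (μ t) (grad (ψ t)) /
          (1 + c * ((R₀ - ∫ s in (0 : ℝ)..t, h s) + ε))) := by
      rw [intervalIntegral.integral_of_le zero_le_one, ← integral_Icc_eq_integral_Ioc,
        ofReal_integral_eq_lintegral_ofReal hint
          ((ae_restrict_mem measurableSet_Icc).mono fun t ht => hEnn t ht),
        restrict_Ioc_eq_restrict_Icc.symm]
      refine setLIntegral_mono_ae' measurableSet_Ioc (Filter.Eventually.of_forall fun t ht => ?_)
      have ht' := Ioc_subset_Icc_self ht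
      have hNe : N t = fun x => μ t x + ((R₀ - ∫ s in (0 : ℝ)..t, h s) + ε) * p x :=
        funext fun x => hNt t ht' x
      simp only [hV, indicator_of_mem ht]
      rw [hNe]
      exact fluxAction_shift_le hw hK (hCE.nonneg t) (hμM t ht') hM hc hp (hρ t ht')
    have hI0 : 0 ≤ ∫ t in (0 : ℝ)..1, normSq K w (μ t) (grad (ψ t)) /
          (1 + c * ((R₀ - ∫ s in (0 : ℝ)..t, h s) + ε)) :=
      intervalIntegral.integral_nonneg zero_le_one hEnn
    rw [habs, ENNReal.ofReal_add (by positivity) (by positivity),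
      ENNReal.ofReal_mul (sq_nonneg b)]
    gcongr

end Flux

/-! ### Quantitative gain -/

lemma sq_intervalIntegral_le {f : ℝ → ℝ} {s t : ℝ} (hst : s ≤ t)
    (hf : IntervalIntegrable f volume s t)
    (hf2 : IntervalIntegrable (fun u => f u ^ 2) volume s t) :
    (∫ u in s..t, f u) ^ 2 ≤ (t - s) * ∫ u in s..t, f u ^ 2 := by
  rcases hst.eq_or_lt with rfl | hlt
  · simp
  set J := ∫ u in s..t, f u with hJ
  have h0 : 0 ≤ ∫ u in s..t, ((t - s) ^ 2 * f u ^ 2 - 2 * (t - s) * J * f u + J ^ 2) :=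
    intervalIntegral.integral_nonneg hst fun u _ => by
      nlinarith [sq_nonneg ((t - s) * f u - J)]
  rw [intervalIntegral.integral_add ((hf2.const_mul _).sub (hf.const_mul _))
    intervalIntegrable_const, intervalIntegral.integral_sub (hf2.const_mul _) (hf.const_mul _),
    intervalIntegral.integral_const_mul, intervalIntegral.integral_const_mul,
    intervalIntegral.integral_const, smul_eq_mul, ← hJ] at h0
  have hpos : 0 < t - s := sub_pos.2 hlt
  refine le_of_sub_nonneg (nonneg_of_mul_nonneg_right (a := t - s) ?_ hpos)
  linarith

/-- Cauchy–Schwarz on the complement of `[τ₀, τ₁]` in `[0,1]`. -/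
lemma sq_add_abs_intervalIntegral_le {f : ℝ → ℝ} {τ₀ τ₁ : ℝ} (h0 : 0 ≤ τ₀) (h01 : τ₀ ≤ τ₁)
    (h1 : τ₁ ≤ 1) (hf : IntervalIntegrable f volume 0 1)
    (hf2 : IntervalIntegrable (fun u => f u ^ 2) volume 0 1) :
    (|∫ u in (0 : ℝ)..τ₀, f u| + |∫ u in τ₁..1, f u|) ^ 2 ≤
      (1 - (τ₁ - τ₀)) * ((∫ u in (0 : ℝ)..1, f u ^ 2) - ∫ u in τ₀..τ₁, f u ^ 2) := by
  have hs : ∀ {s t : ℝ}, 0 ≤ s → s ≤ t → t ≤ 1 → uIcc s t ⊆ uIcc (0 : ℝ) 1 :=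
    fun h h' h'' => by
      rw [uIcc_of_le h', uIcc_of_le zero_le_one]
      exact Icc_subset_Icc h h''
  have s1 := hs le_rfl h0 (h01.trans h1)
  have s2 := hs h0 h01 h1
  have s3 := hs (h0.trans h01) h1 le_rfl
  have c1 := sq_intervalIntegral_le h0 (hf.mono_set s1) (hf2.mono_set s1)
  have c3 := sq_intervalIntegral_le h1 (hf.mono_set s3) (hf2.mono_set s3)
  have hsplit : (∫ u in (0 : ℝ)..1, f u ^ 2) - ∫ u in τ₀..τ₁, f u ^ 2 =
      (∫ u in (0 : ℝ)..τ₀, f u ^ 2) + ∫ u in τ₁..1, f u ^ 2 := by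
    rw [← intervalIntegral.integral_add_adjacent_intervals (hf2.mono_set s1)
      ((hf2.mono_set s2).trans (hf2.mono_set s3)),
      ← intervalIntegral.integral_add_adjacent_intervals (hf2.mono_set s2) (hf2.mono_set s3)]
    ring
  rw [hsplit]
  have q1 : 0 ≤ ∫ u in (0 : ℝ)..τ₀, f u ^ 2 :=
    intervalIntegral.integral_nonneg h0 fun u _ => sq_nonneg _
  have q3 : 0 ≤ ∫ u in τ₁..1, f u ^ 2 :=
    intervalIntegral.integral_nonneg h1 fun u _ => sq_nonneg _
  generalize (∫ u in (0 : ℝ)..τ₀, f u) = x at *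
  generalize (∫ u in τ₁..1, f u) = y at *
  generalize (∫ u in (0 : ℝ)..τ₀, f u ^ 2) = A at *
  generalize (∫ u in τ₁..1, f u ^ 2) = B at *
  rw [sub_zero] at c1
  have hτ : 0 ≤ 1 - τ₁ := sub_nonneg.2 h1
  have hcross : 2 * (|x| * |y|) ≤ τ₀ * B + (1 - τ₁) * A := by
    refine abs_le_of_sq_le_sq' ?_ (by positivity) |>.2
    have hmul : x ^ 2 * y ^ 2 ≤ τ₀ * A * ((1 - τ₁) * B) :=
      mul_le_mul c1 c3 (sq_nonneg y) (by positivity)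
    calc (2 * (|x| * |y|)) ^ 2 = 4 * (x ^ 2 * y ^ 2) := by rw [← sq_abs x, ← sq_abs y]; ring
      _ ≤ 4 * (τ₀ * A * ((1 - τ₁) * B)) := by linarith
      _ ≤ _ := by nlinarith [sq_nonneg (τ₀ * B - (1 - τ₁) * A)]
  calc (|x| + |y|) ^ 2 = x ^ 2 + y ^ 2 + 2 * (|x| * |y|) := by
        rw [← sq_abs x, ← sq_abs y]; ring
    _ ≤ τ₀ * A + (1 - τ₁) * B + (τ₀ * B + (1 - τ₁) * A) := by linarith
    _ = _ := by ring

/-- The three sources of gain, made uniform. Here `R` is the total shift, `Q = ∫ h²`, the kinetic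
energy is `e₁` outside and `e₂` inside a time interval of length `T` off which the shift is at
least `η`. If `R` is small, shifting by a little more reduces the action; if `e₁` is not small,
the shift has reduced it already; otherwise `T` is not small, and squeezing the source into the
remaining time makes `Q` larger than `R²`. -/
lemma exists_uniform_gap {a b c κ C : ℝ} (ha : 0 < a) (hb : 0 < b) (hc : 0 < c) (hκ : 0 < κ)
    (hC : 0 < C) :
    ∃ δ > 0, ∃ η > 0, ∀ R Q T e₁ e₂ d : ℝ, 0 ≤ R → R ^ 2 ≤ Q →
      (2 * η ≤ R → (R - 2 * η) ^ 2 ≤ (1 - T) * Q) → 0 ≤ T → T ≤ 1 → 0 ≤ e₁ → 0 ≤ e₂ →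
      κ ≤ e₁ + T * e₂ → b ^ 2 * (e₁ + e₂) ≤ C →
      d ≤ a ^ 2 * R ^ 2 + b ^ 2 * (e₁ / (1 + c * η) + e₂) →
      (∀ ε > 0, d ≤ a ^ 2 * (R + 2 * ε) ^ 2 + b ^ 2 * ((e₁ + e₂) / (1 + c * ε))) →
      d + δ ≤ a ^ 2 * Q + b ^ 2 * (e₁ + e₂) := by
  obtain ⟨ε, hε, hεc, hεa⟩ : ∃ ε > 0, c * ε ≤ 1 ∧ 32 * a ^ 2 * ε ≤ b ^ 2 * κ * c := by
    refine ⟨min (1 / c) (b ^ 2 * κ * c / (32 * a ^ 2)), by positivity, ?_, ?_⟩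
    · have := min_le_left (1 / c) (b ^ 2 * κ * c / (32 * a ^ 2))
      rw [le_div_iff₀ hc] at this
      linarith
    · have := min_le_right (1 / c) (b ^ 2 * κ * c / (32 * a ^ 2))
      rw [le_div_iff₀ (by positivity)] at this
      linarith
  set T₀ := κ * b ^ 2 / (2 * C) with hT₀
  have hT₀pos : 0 < T₀ := by positivity
  set η := T₀ * ε / 8 with hη
  have hηpos : 0 < η := by positivity
  have hcη : 0 < 1 + c * η := by positivity
  refine ⟨min (b ^ 2 * κ * c * ε / 4) (min (b ^ 2 * (κ / 2 * (c * η / (1 + c * η))))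
    (a ^ 2 * (T₀ * ε ^ 2 / 2))), by positivity, η, hηpos, ?_⟩
  intro R Q T e₁ e₂ d hR hRQ hsq hT hT1 he₁ he₂ hκe hCe hd hdε
  rcases le_total R ε with hRε | hRε
  · refine (add_le_add_right (min_le_left _ _) d).trans ?_
    have he : κ ≤ e₁ + e₂ := hκe.trans (by nlinarith)
    have h1 : (e₁ + e₂) / (1 + c * ε) ≤ (e₁ + e₂) * (1 - c * ε / 2) := by
      rw [div_le_iff₀ (by positivity), mul_assoc]
      refine le_mul_of_one_le_right (by linarith) ?_
      nlinarith [mul_pos hc hε]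
    have h2 := mul_le_mul_of_nonneg_left h1 (sq_nonneg b)
    have h3 : b ^ 2 * κ * (c * ε / 2) ≤ b ^ 2 * (e₁ + e₂) * (c * ε / 2) := by gcongr
    have h4 : 32 * a ^ 2 * ε * ε ≤ b ^ 2 * κ * c * ε := by gcongr
    have h5 : a ^ 2 * R * ε ≤ a ^ 2 * ε * ε := by gcongr
    have h6 : a ^ 2 * R ^ 2 ≤ a ^ 2 * Q := by gcongr
    nlinarith [hdε ε hε]
  · have h6 : a ^ 2 * R ^ 2 ≤ a ^ 2 * Q := by gcongr
    have hdiv : e₁ / (1 + c * η) = e₁ - e₁ * (c * η / (1 + c * η)) := by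
      field_simp
      ring
    have hfrac : 0 ≤ c * η / (1 + c * η) := by positivity
    rcases le_total (κ / 2) e₁ with he | he
    · refine (add_le_add_right ((min_le_right _ _).trans (min_le_left _ _)) d).trans ?_
      have h7 : b ^ 2 * (κ / 2 * (c * η / (1 + c * η))) ≤
        b ^ 2 * (e₁ * (c * η / (1 + c * η))) := by gcongr
      rw [hdiv] at hd
      linarith
    · refine (add_le_add_right ((min_le_right _ _).trans (min_le_right _ _)) d).trans ?_
      have hTT : T₀ ≤ T := by
        rw [hT₀, div_le_iff₀ (by positivity)]
        have h8 : κ / 2 ≤ T * e₂ := by linarith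
        have h9 : b ^ 2 * e₂ ≤ C := by nlinarith [mul_nonneg (sq_nonneg b) he₁]
        have h10 := mul_le_mul_of_nonneg_left h9 hT
        have h11 := mul_le_mul_of_nonneg_left h8 (sq_nonneg b)
        linarith
      have h2η : 2 * η ≤ R := by
        have : T₀ * ε ≤ 1 * ε := by gcongr; linarith
        rw [hη]; linarith
      have h12 := hsq h2η
      have hQ : 0 ≤ Q := (sq_nonneg R).trans hRQ
      have h13 : T₀ * Q ≤ T * Q := by gcongr
      have h14 : R * (T₀ * ε) ≤ R * (T₀ * R) := by gcongr
      have h15 : T₀ * R ^ 2 ≤ T₀ * Q := by gcongr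
      have h16 : T₀ * ε ^ 2 ≤ T₀ * R ^ 2 := by gcongr
      have h17 : T₀ * ε ^ 2 / 2 ≤ Q - R ^ 2 := by
        rw [hη] at h12
        nlinarith [sq_nonneg (T₀ * ε)]
      have h18 := mul_le_mul_of_nonneg_left h17 (sq_nonneg a)
      have h19 : 0 ≤ b ^ 2 * (e₁ * (c * η / (1 + c * η))) := by positivity
      rw [hdiv] at hd
      linarith

/-- Let the excess shift `ε` tend to zero, and bound the shift below by `η` off `[τ₀, τ₁]`. -/
lemma le_of_forall_excess {D : ℝ≥0∞} {a b c R₀ η τ₀ τ₁ : ℝ} {E h : ℝ → ℝ}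
    (hc : 0 < c) (hE0 : ∀ t, 0 ≤ E t) (hh : IntervalIntegrable h volume 0 1)
    (hE : IntervalIntegrable E volume 0 1)
    (hR₀ : ∀ t ∈ Icc (0 : ℝ) 1, ∫ s in (0 : ℝ)..t, h s ≤ R₀)
    (hD : ∀ ε > 0, D ≤ ENNReal.ofReal (a ^ 2 * (R₀ + (R₀ - ∫ t in (0 : ℝ)..1, h t) + 2 * ε) ^ 2 +
      b ^ 2 * ∫ t in (0 : ℝ)..1, E t / (1 + c * ((R₀ - ∫ s in (0 : ℝ)..t, h s) + ε))))
    (h0 : 0 ≤ τ₀) (h01 : τ₀ ≤ τ₁) (h1 : τ₁ ≤ 1) (hη : 0 ≤ η)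
    (hr : ∀ t ∈ Icc (0 : ℝ) 1, t < τ₀ ∨ τ₁ < t → η ≤ R₀ - ∫ s in (0 : ℝ)..t, h s) :
    D ≤ ENNReal.ofReal (a ^ 2 * (R₀ + (R₀ - ∫ t in (0 : ℝ)..1, h t)) ^ 2 +
      b ^ 2 * (((∫ t in (0 : ℝ)..1, E t) - ∫ t in τ₀..τ₁, E t) / (1 + c * η) +
        ∫ t in τ₀..τ₁, E t)) := by
  have hs : ∀ {s t : ℝ}, 0 ≤ s → s ≤ t → t ≤ 1 → uIcc s t ⊆ uIcc (0 : ℝ) 1 :=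
    fun h h' h'' => by
      rw [uIcc_of_le h', uIcc_of_le zero_le_one]
      exact Icc_subset_Icc h h''
  have s1 := hs le_rfl h0 (h01.trans h1)
  have s2 := hs h0 h01 h1
  have s3 := hs (h0.trans h01) h1 le_rfl
  have hbound : ∀ ε > 0, ∫ t in (0 : ℝ)..1, E t / (1 + c * ((R₀ - ∫ s in (0 : ℝ)..t, h s) + ε)) ≤
      ((∫ t in (0 : ℝ)..1, E t) - ∫ t in τ₀..τ₁, E t) / (1 + c * η) + ∫ t in τ₀..τ₁, E t := by
    intro ε hε
    have hI := intervalIntegrable_div_shift hh hE hc hR₀ hε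
    have hr0 : ∀ t ∈ Icc (0 : ℝ) 1, 0 ≤ R₀ - ∫ s in (0 : ℝ)..t, h s := fun t ht =>
      sub_nonneg.2 (hR₀ t ht)
    have hout : ∀ t ∈ Icc (0 : ℝ) 1, t < τ₀ ∨ τ₁ < t →
        E t / (1 + c * ((R₀ - ∫ s in (0 : ℝ)..t, h s) + ε)) ≤ E t / (1 + c * η) :=
      fun t ht ht' => by
        have := hr t ht ht'
        refine div_le_div_of_nonneg_left (hE0 t) (by positivity) ?_
        gcongr
        linarith
    have b1 := intervalIntegral.integral_mono_on_of_le_Ioo h0 (hI.mono_set s1)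
      ((hE.mono_set s1).div_const (1 + c * η)) fun t ht =>
        hout t ⟨ht.1.le, ht.2.le.trans (h01.trans h1)⟩ (Or.inl ht.2)
    have b2 := intervalIntegral.integral_mono_on_of_le_Ioo h01 (hI.mono_set s2)
      (hE.mono_set s2) fun t ht => by
        have := hr0 t ⟨h0.trans ht.1.le, ht.2.le.trans h1⟩
        exact div_le_self (hE0 t) (by
          have : 0 ≤ c * ((R₀ - ∫ s in (0 : ℝ)..t, h s) + ε) := by positivity
          linarith)
    have b3 := intervalIntegral.integral_mono_on_of_le_Ioo h1 (hI.mono_set s3)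
      ((hE.mono_set s3).div_const (1 + c * η)) fun t ht =>
        hout t ⟨(h0.trans h01).trans ht.1.le, ht.2.le⟩ (Or.inr ht.1)
    rw [intervalIntegral.integral_div] at b1 b3
    have e1 := intervalIntegral.integral_add_adjacent_intervals (hI.mono_set s1)
      ((hI.mono_set s2).trans (hI.mono_set s3))
    have e2 := intervalIntegral.integral_add_adjacent_intervals (hI.mono_set s2) (hI.mono_set s3)
    have e3 := intervalIntegral.integral_add_adjacent_intervals (hE.mono_set s1)
      ((hE.mono_set s2).trans (hE.mono_set s3))
    have e4 := intervalIntegral.integral_add_adjacent_intervals (hE.mono_set s2) (hE.mono_set s3)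
    have e5 : (∫ t in (0 : ℝ)..1, E t) - ∫ t in τ₀..τ₁, E t =
        (∫ t in (0 : ℝ)..τ₀, E t) + ∫ t in τ₁..1, E t := by linarith
    rw [e5, add_div]
    linarith
  have hlim : Filter.Tendsto (fun ε : ℝ => ENNReal.ofReal
      (a ^ 2 * (R₀ + (R₀ - ∫ t in (0 : ℝ)..1, h t) + 2 * ε) ^ 2 +
      b ^ 2 * (((∫ t in (0 : ℝ)..1, E t) - ∫ t in τ₀..τ₁, E t) / (1 + c * η) +
        ∫ t in τ₀..τ₁, E t))) (nhdsWithin 0 (Ioi 0)) (nhds (ENNReal.ofReal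
      (a ^ 2 * (R₀ + (R₀ - ∫ t in (0 : ℝ)..1, h t)) ^ 2 +
      b ^ 2 * (((∫ t in (0 : ℝ)..1, E t) - ∫ t in τ₀..τ₁, E t) / (1 + c * η) +
        ∫ t in τ₀..τ₁, E t)))) := by
    have : Continuous fun ε : ℝ => ENNReal.ofReal
      (a ^ 2 * (R₀ + (R₀ - ∫ t in (0 : ℝ)..1, h t) + 2 * ε) ^ 2 +
      b ^ 2 * (((∫ t in (0 : ℝ)..1, E t) - ∫ t in τ₀..τ₁, E t) / (1 + c * η) +
        ∫ t in τ₀..τ₁, E t)) := ENNReal.continuous_ofReal.comp (by fun_prop)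
    simpa using (this.tendsto 0).mono_left nhdsWithin_le_nhds
  refine ge_of_tendsto hlim (Filter.eventually_of_mem self_mem_nhdsWithin fun ε hε => ?_)
  refine (hD ε hε).trans (ENNReal.ofReal_le_ofReal ?_)
  have := mul_le_mul_of_nonneg_left (hbound ε hε) (sq_nonneg b)
  linarith

/-- The primitive of `h` attains its maximum on `[0,1]`. With `R₀` this maximum, the total shift
`R₀ + (R₀ - ∫ h)` is at most the total variation `∫ |h|`, hence at most `√(∫ h²)`. -/
lemma exists_max_primitive {h : ℝ → ℝ} (hh : IntervalIntegrable h volume 0 1)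
    (hh2 : IntervalIntegrable (fun t => h t ^ 2) volume 0 1) :
    ∃ R₀, (∀ t ∈ Icc (0 : ℝ) 1, ∫ s in (0 : ℝ)..t, h s ≤ R₀) ∧
      (∃ t ∈ Icc (0 : ℝ) 1, ∫ s in (0 : ℝ)..t, h s = R₀) ∧
      (R₀ + (R₀ - ∫ t in (0 : ℝ)..1, h t)) ^ 2 ≤ ∫ t in (0 : ℝ)..1, h t ^ 2 := by
  have hcont := intervalIntegral.continuousOn_primitive_interval' hh (a := 0) (by simp)
  rw [uIcc_of_le zero_le_one] at hcont
  obtain ⟨σ, hσ, hmax⟩ := isCompact_Icc.exists_isMaxOn ⟨0, by simp⟩ hcont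
  have hmax' : ∀ t ∈ Icc (0 : ℝ) 1, ∫ s in (0 : ℝ)..t, h s ≤ ∫ s in (0 : ℝ)..σ, h s :=
    fun t ht => hmax ht
  refine ⟨∫ s in (0 : ℝ)..σ, h s, hmax', ⟨σ, hσ, rfl⟩, ?_⟩
  have h1 := sq_add_abs_intervalIntegral_le hσ.1 le_rfl hσ.2 hh hh2
  simp only [sub_self, sub_zero, one_mul, intervalIntegral.integral_same] at h1
  refine le_trans ?_ h1
  have hadd : (∫ s in (0 : ℝ)..σ, h s) + ∫ s in σ..1, h s = ∫ s in (0 : ℝ)..1, h s :=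
    intervalIntegral.integral_add_adjacent_intervals
      (hh.mono_set (uIcc_subset_uIcc_left (by rwa [uIcc_of_le zero_le_one])))
      (hh.mono_set (uIcc_subset_uIcc_right (by rwa [uIcc_of_le zero_le_one])))
  have hr0 := hmax' 0 (by simp)
  have hr1 := hmax' 1 (by simp)
  rw [intervalIntegral.integral_same] at hr0
  refine pow_le_pow_left₀ (by linarith) ?_ 2
  linarith [le_abs_self (∫ s in (0 : ℝ)..σ, h s), neg_le_abs (∫ s in σ..1, h s)]

/-- The uniform gain for a single curve, in terms of its source `h` and its kinetic energy `E`.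
The window `[τ₀, τ₁]` is bounded by the first and the last time at which the shift is at
most `η`. -/
lemma exists_gap_of_forall_excess {a b c κ C : ℝ} (ha : 0 < a) (hb : 0 < b) (hc : 0 < c)
    (hκ : 0 < κ) (hC : 0 < C) :
    ∃ δ > 0, ∀ (D : ℝ≥0∞) (E h : ℝ → ℝ) (R₀ : ℝ), D ≠ ∞ → (∀ t, 0 ≤ E t) →
      IntervalIntegrable h volume 0 1 → IntervalIntegrable (fun t => h t ^ 2) volume 0 1 →
      IntervalIntegrable E volume 0 1 → IntervalIntegrable (fun t => √(E t)) volume 0 1 →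
      (∀ t ∈ Icc (0 : ℝ) 1, ∫ s in (0 : ℝ)..t, h s ≤ R₀) →
      (∃ t ∈ Icc (0 : ℝ) 1, ∫ s in (0 : ℝ)..t, h s = R₀) →
      (R₀ + (R₀ - ∫ t in (0 : ℝ)..1, h t)) ^ 2 ≤ ∫ t in (0 : ℝ)..1, h t ^ 2 →
      (∀ ε > 0, D ≤ ENNReal.ofReal
        (a ^ 2 * (R₀ + (R₀ - ∫ t in (0 : ℝ)..1, h t) + 2 * ε) ^ 2 +
          b ^ 2 * ∫ t in (0 : ℝ)..1, E t / (1 + c * ((R₀ - ∫ s in (0 : ℝ)..t, h s) + ε)))) →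
      κ ≤ ∫ t in (0 : ℝ)..1, √(E t) →
      b ^ 2 * ∫ t in (0 : ℝ)..1, E t ≤ C →
      D + ENNReal.ofReal δ ≤ ENNReal.ofReal (a ^ 2 * (∫ t in (0 : ℝ)..1, h t ^ 2) +
        b ^ 2 * ∫ t in (0 : ℝ)..1, E t) := by
  obtain ⟨δ, hδ, η, hη, key⟩ := exists_uniform_gap (κ := κ ^ 2 / 2) ha hb hc (by positivity) hC
  refine ⟨δ, hδ, fun D E h R₀ hDtop hE0 hh hh2 hE hEs hR₀ hattain hRQ hD hκE hEC => ?_⟩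
  have hcont := intervalIntegral.continuousOn_primitive_interval' hh (a := 0) (by simp)
  rw [uIcc_of_le zero_le_one] at hcont
  have hZ : IsCompact (Icc (0 : ℝ) 1 ∩ {t | R₀ - ∫ s in (0 : ℝ)..t, h s ≤ η}) :=
    isCompact_Icc.of_isClosed_subset
      ((continuousOn_const.sub hcont).preimage_isClosed_of_isClosed isClosed_Icc isClosed_Iic)
      inter_subset_left
  have hZne : (Icc (0 : ℝ) 1 ∩ {t | R₀ - ∫ s in (0 : ℝ)..t, h s ≤ η}).Nonempty := by
    obtain ⟨t, ht, hteq⟩ := hattain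
    exact ⟨t, ht, by simpa [hteq] using hη.le⟩
  obtain ⟨τ₀, hτ₀, hleast⟩ := hZ.exists_isLeast hZne
  obtain ⟨τ₁, hτ₁, hgreatest⟩ := hZ.exists_isGreatest hZne
  have h0 : 0 ≤ τ₀ := hτ₀.1.1
  have h1 : τ₁ ≤ 1 := hτ₁.1.2
  have h01 : τ₀ ≤ τ₁ := hleast hτ₁
  have hr : ∀ t ∈ Icc (0 : ℝ) 1, t < τ₀ ∨ τ₁ < t → η ≤ R₀ - ∫ s in (0 : ℝ)..t, h s := by
    intro t ht hor
    by_contra hlt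
    have hmem : t ∈ Icc (0 : ℝ) 1 ∩ {t | R₀ - ∫ s in (0 : ℝ)..t, h s ≤ η} :=
      ⟨ht, (not_le.1 hlt).le⟩
    rcases hor with hl | hg
    · exact absurd (hleast hmem) hl.not_ge
    · exact absurd (hgreatest hmem) hg.not_ge
  have hs2 : uIcc τ₀ τ₁ ⊆ uIcc (0 : ℝ) 1 := by
    rw [uIcc_of_le h01, uIcc_of_le zero_le_one]
    exact Icc_subset_Icc h0 h1
  have hs3 : uIcc τ₁ 1 ⊆ uIcc (0 : ℝ) 1 :=
    uIcc_subset_uIcc_right (by rw [uIcc_of_le zero_le_one]; exact hτ₁.1)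
  have hs1 : uIcc 0 τ₀ ⊆ uIcc (0 : ℝ) 1 :=
    uIcc_subset_uIcc_left (by rw [uIcc_of_le zero_le_one]; exact hτ₀.1)
  have hsq : ∀ t, √(E t) ^ 2 = E t := fun t => Real.sq_sqrt (hE0 t)
  have hEs2 : IntervalIntegrable (fun t => √(E t) ^ 2) volume 0 1 := by simpa only [hsq] using hE
  have hr0 : 0 ≤ R₀ := by simpa using hR₀ 0 (by simp)
  have hr1 : 0 ≤ R₀ - ∫ t in (0 : ℝ)..1, h t := sub_nonneg.2 (hR₀ 1 (by simp))
  set e₂ := ∫ t in τ₀..τ₁, E t with he₂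
  set e := ∫ t in (0 : ℝ)..1, E t with he
  have he₂0 : 0 ≤ e₂ := intervalIntegral.integral_nonneg h01 fun t _ => hE0 t
  have he₁0 : 0 ≤ e - e₂ := by
    have := intervalIntegral.integral_mono_interval h0 h01 h1
      (Filter.Eventually.of_forall hE0) hE
    linarith
  have hrel := le_of_forall_excess hc hE0 hh hE hR₀ hD h0 h01 h1 hη.le hr
  have hQ0 : 0 ≤ ∫ t in (0 : ℝ)..1, h t ^ 2 :=
    intervalIntegral.integral_nonneg zero_le_one fun t _ => sq_nonneg _
  have hfinal : D.toReal + δ ≤ a ^ 2 * (∫ t in (0 : ℝ)..1, h t ^ 2) + b ^ 2 * ((e - e₂) + e₂) := by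
    refine key (R₀ + (R₀ - ∫ t in (0 : ℝ)..1, h t)) _ (τ₁ - τ₀) (e - e₂) e₂ _ (by linarith) hRQ
      (fun h2η => ?_) (by linarith) (by linarith) he₁0 he₂0 ?_ (by simpa using hEC) ?_ ?_
    · have hcs := sq_add_abs_intervalIntegral_le h0 h01 h1 hh hh2
      have hmid : 0 ≤ ∫ u in τ₀..τ₁, h u ^ 2 :=
        intervalIntegral.integral_nonneg h01 fun t _ => sq_nonneg _
      have hT : 0 ≤ 1 - (τ₁ - τ₀) := by linarith
      have hadd := intervalIntegral.integral_add_adjacent_intervals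
        (hh.mono_set (uIcc_subset_uIcc_left (by rw [uIcc_of_le zero_le_one]; exact hτ₁.1)))
        (hh.mono_set hs3)
      have hz₀ : R₀ - ∫ s in (0 : ℝ)..τ₀, h s ≤ η := hτ₀.2
      have hz₁ : R₀ - ∫ s in (0 : ℝ)..τ₁, h s ≤ η := hτ₁.2
      calc _ ≤ (|∫ u in (0 : ℝ)..τ₀, h u| + |∫ u in τ₁..1, h u|) ^ 2 := by
            refine pow_le_pow_left₀ (by linarith) ?_ 2
            linarith [le_abs_self (∫ s in (0 : ℝ)..τ₀, h s), neg_le_abs (∫ s in τ₁..1, h s)]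
        _ ≤ _ := hcs.trans (mul_le_mul_of_nonneg_left (by linarith) hT)
    · have c1 := sq_add_abs_intervalIntegral_le h0 h01 h1 hEs hEs2
      have c2 := sq_intervalIntegral_le h01 (hEs.mono_set hs2) (hEs2.mono_set hs2)
      simp only [hsq] at c1 c2
      rw [← he, ← he₂] at c1
      rw [← he₂] at c2
      have e1 := intervalIntegral.integral_add_adjacent_intervals (hEs.mono_set hs1)
        ((hEs.mono_set hs2).trans (hEs.mono_set hs3))
      have e2 := intervalIntegral.integral_add_adjacent_intervals (hEs.mono_set hs2)
        (hEs.mono_set hs3)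
      have c3 : (1 - (τ₁ - τ₀)) * (e - e₂) ≤ 1 * (e - e₂) := by
        gcongr
        linarith
      set x := |∫ u in (0 : ℝ)..τ₀, √(E u)| + |∫ u in τ₁..1, √(E u)|
      have hx : κ ≤ x + ∫ u in τ₀..τ₁, √(E u) := by
        linarith [le_abs_self (∫ s in (0 : ℝ)..τ₀, √(E s)), le_abs_self (∫ s in τ₁..1, √(E s))]
      have hκ2 := pow_le_pow_left₀ hκ.le hx 2
      nlinarith [sq_nonneg (x - ∫ u in τ₀..τ₁, √(E u))]
    · exact ENNReal.toReal_le_of_le_ofReal (by positivity) hrel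
    · intro ε hε
      have hpos : 0 < 1 + c * ε := by positivity
      rw [sub_add_cancel]
      refine ENNReal.toReal_le_of_le_ofReal ?_ ((hD ε hε).trans (ENNReal.ofReal_le_ofReal ?_))
      · have : 0 ≤ e := by linarith
        positivity
      · gcongr
        rw [he, ← intervalIntegral.integral_div]
        refine intervalIntegral.integral_mono_on zero_le_one
          (intervalIntegrable_div_shift hh hE hc hR₀ hε) (hE.div_const _) fun t ht => ?_
        have := hR₀ t ht
        refine div_le_div_of_nonneg_left (hE0 t) hpos ?_
        gcongr
        linarith
  rw [sub_add_cancel] at hfinal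
  rw [← ENNReal.ofReal_toReal hDtop, ← ENNReal.ofReal_add ENNReal.toReal_nonneg hδ.le]
  exact ENNReal.ofReal_le_ofReal hfinal

/-! ### Uniform bounds for curves of bounded action -/

section UniformBounds

variable {X : Type*} [Fintype X] {K : Matrix X X ℝ} {w : X → ℝ} {p μ₀ μ₁ : X → ℝ} {a b : ℝ}

/-- Curves of bounded action are uniformly bounded, because the source controls the mass. -/
lemma exists_uniform_bound (hw : ∀ x, 0 < w x) (hrev : ∀ x y, K x y * w x = K y x * w y)
    (hpm : ∑ x, w x * p x = 1) (Q : ℝ) :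
    ∃ M, 0 < M ∧ ∀ (μ ψ : ℝ → X → ℝ) (h : ℝ → ℝ), IsIntegralCE K p μ₀ μ₁ μ ψ h →
      IntervalIntegrable h volume 0 1 → IntervalIntegrable (fun t => h t ^ 2) volume 0 1 →
      ∫ t in (0 : ℝ)..1, h t ^ 2 ≤ Q → ∀ t ∈ Icc (0 : ℝ) 1, ∀ x, μ t x ≤ M := by
  obtain ⟨M, hM, hle⟩ := exists_pos_forall_le fun x => (∑ x, w x * μ₀ x + 1 + Q) / w x
  refine ⟨M, hM, fun μ ψ h hCE hh hh2 hQ t ht x => le_trans ?_ (hle x)⟩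
  rw [le_div_iff₀ (hw x), mul_comm]
  have h1 : w x * μ t x ≤ ∑ x, w x * μ t x :=
    Finset.single_le_sum (f := fun x => w x * μ t x)
      (fun x _ => mul_nonneg (hw x).le (hCE.nonneg t x)) (Finset.mem_univ x)
  rw [hCE.sum_mul_eq hrev hpm ht] at h1
  have hsub : uIcc (0 : ℝ) t ⊆ uIcc 0 1 := uIcc_subset_uIcc_left (by rwa [uIcc_of_le zero_le_one])
  have hi : IntervalIntegrable (fun t => 1 + h t ^ 2) volume 0 1 :=
    intervalIntegrable_const.add hh2
  have h2 : ∫ s in (0 : ℝ)..t, h s ≤ ∫ s in (0 : ℝ)..t, (1 + h s ^ 2) :=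
    intervalIntegral.integral_mono_on ht.1 (hh.mono_set hsub) (hi.mono_set hsub) fun s _ => by
      nlinarith [sq_nonneg (h s - 1)]
  have h3 : ∫ s in (0 : ℝ)..t, (1 + h s ^ 2) ≤ ∫ s in (0 : ℝ)..1, (1 + h s ^ 2) :=
    intervalIntegral.integral_mono_interval le_rfl ht.1 ht.2
      (Filter.Eventually.of_forall fun s => by positivity) hi
  have h4 : ∫ s in (0 : ℝ)..1, (1 + h s ^ 2) = 1 + ∫ s in (0 : ℝ)..1, h s ^ 2 := by
    rw [intervalIntegral.integral_add intervalIntegrable_const hh2]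
    simp
  linarith

lemma exists_div_ne_div_of_notMem_span {f p : X → ℝ} (hp : ∀ x, 0 < p x)
    (hf : f ∉ Submodule.span ℝ {p}) : ∃ x y, f x / p x ≠ f y / p y := by
  by_contra! hall
  refine hf (Submodule.mem_span_singleton.2 ?_)
  rcases isEmpty_or_nonempty X with hX | ⟨⟨y⟩⟩
  · exact ⟨0, funext fun x => hX.elim x⟩
  · refine ⟨f y / p y, funext fun x => ?_⟩
    rw [Pi.smul_apply, smul_eq_mul, ← hall x y, div_mul_cancel₀ _ (hp x).ne']

/-- If `μ₀ - μ₁` is not a multiple of `p`, the source alone cannot connect the two densities: some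
linear functional that kills `p` distinguishes them, and only the transport part moves it. -/
lemma exists_lower_bound_integral_sqrt (hw : ∀ x, 0 < w x) (hK : ∀ x y, 0 ≤ K x y)
    (hrev : ∀ x y, K x y * w x = K y x * w y) (hp : ∀ x, 0 < p x)
    (hspan : μ₀ - μ₁ ∉ Submodule.span ℝ {p}) (M : ℝ) :
    ∃ κ > 0, ∀ (μ ψ : ℝ → X → ℝ) (h : ℝ → ℝ), IsIntegralCE K p μ₀ μ₁ μ ψ h →
      (∀ t ∈ Icc (0 : ℝ) 1, ∀ x, μ t x ≤ M) →
      IntervalIntegrable (fun t => normSq K w (μ t) (grad (ψ t))) volume 0 1 →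
      κ ≤ ∫ t in (0 : ℝ)..1, √(normSq K w (μ t) (grad (ψ t))) := by
  have hKw : ∀ x y, 0 ≤ K x y * w x := fun x y => mul_nonneg (hK x y) (hw x).le
  obtain ⟨x, y, hxy⟩ := exists_div_ne_div_of_notMem_span hp hspan
  obtain ⟨Lx, hLx0, hLx⟩ := exists_abs_divergence_edgeFlux_le hw hK M x
  obtain ⟨Ly, hLy0, hLy⟩ := exists_abs_divergence_edgeFlux_le hw hK M y
  have hpx := hp x
  have hpy := hp y
  set q := (μ₀ - μ₁) x / p x - (μ₀ - μ₁) y / p y with hq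
  have hq0 : 0 < |q| := abs_pos.2 (sub_ne_zero.2 hxy)
  set L := Lx / p x + Ly / p y + 1 with hL
  have hLpos : 0 < L := by positivity
  refine ⟨|q| / L, div_pos hq0 hLpos, fun μ ψ h hCE hM hE => ?_⟩
  rw [div_le_iff₀ hLpos, mul_comm]
  have hEs := hCE.intervalIntegrable_sqrt_normSq hKw hE
  have hint : q = ∫ t in (0 : ℝ)..1,
      ((h t * p y - divergence K (fun u v => mobility (μ t) u v * grad (ψ t) u v) y) / p y -
      (h t * p x - divergence K (fun u v => mobility (μ t) u v * grad (ψ t) u v) x) / p x) := by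
    have ex := hCE.primitive 1 (by simp) x
    have ey := hCE.primitive 1 (by simp) y
    rw [hCE.right] at ex ey
    rw [intervalIntegral.integral_sub ((hCE.integrable y).div_const _)
      ((hCE.integrable x).div_const _), intervalIntegral.integral_div,
      intervalIntegral.integral_div, hq, Pi.sub_apply, Pi.sub_apply, ex, ey]
    ring
  rw [hint, ← Real.norm_eq_abs, ← intervalIntegral.integral_const_mul]
  refine intervalIntegral.norm_integral_le_of_norm_le zero_le_one
    (Filter.Eventually.of_forall fun t ht => ?_) (hEs.const_mul L)
  have ht' := Ioc_subset_Icc_self ht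
  have hx' := hLx (μ t) (ψ t) (hCE.nonneg t) (hM t ht')
  have hy' := hLy (μ t) (ψ t) (hCE.nonneg t) (hM t ht')
  rw [divergence_edgeFlux hw hrev] at hx' hy'
  set dx := divergence K (fun u v => mobility (μ t) u v * grad (ψ t) u v) x
  set dy := divergence K (fun u v => mobility (μ t) u v * grad (ψ t) u v) y
  set s := √(normSq K w (μ t) (grad (ψ t))) with hs
  have hs0 : 0 ≤ s := Real.sqrt_nonneg _
  have hrw : (h t * p y - dy) / p y - (h t * p x - dx) / p x = dx / p x - dy / p y := by
    field_simp
    ring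
  rw [hrw, Real.norm_eq_abs]
  calc |dx / p x - dy / p y| ≤ |dx / p x| + |dy / p y| := abs_sub _ _
    _ = |dx| / p x + |dy| / p y := by
      rw [abs_div, abs_div, abs_of_pos hpx, abs_of_pos hpy]
    _ ≤ Lx * s / p x + Ly * s / p y := by gcongr
    _ ≤ L * s := by
      rw [hL]
      have : (Lx / p x + Ly / p y + 1) * s = Lx * s / p x + Ly * s / p y + s := by ring
      linarith

/-! ### Comparison of the two distances -/

/-- The bound of `distD` by the action of a single curve, with a gain that is uniform over all
curves of action at most `C` when `μ₀ - μ₁` is not a multiple of `p`. -/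
theorem distD_sq_le_potentialAction (hw : ∀ x, 0 < w x) (hK : ∀ x y, 0 ≤ K x y)
    (hrev : ∀ x y, K x y * w x = K y x * w y) (ha : 0 < a) (hb : 0 < b)
    (hp : ∀ x, 0 < p x) (hpm : ∑ x, w x * p x = 1)
    (hμ₀ : ∀ x, 0 ≤ μ₀ x) (hμ₁ : ∀ x, 0 ≤ μ₁ x) (hD : distD K w p a b μ₀ μ₁ < ∞)
    {C : ℝ} (hC : 0 < C) :
    (∀ μ ψ h, IsCE K p μ₀ μ₁ μ ψ h → potentialAction K w a b μ ψ h ≤ ENNReal.ofReal C →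
      distD K w p a b μ₀ μ₁ ^ 2 ≤ potentialAction K w a b μ ψ h) ∧
    (μ₀ - μ₁ ∉ Submodule.span ℝ {p} → ∃ δ > 0, ∀ μ ψ h, IsCE K p μ₀ μ₁ μ ψ h →
      potentialAction K w a b μ ψ h ≤ ENNReal.ofReal C →
      distD K w p a b μ₀ μ₁ ^ 2 + ENNReal.ofReal δ ≤ potentialAction K w a b μ ψ h) := by
  have hKw : ∀ x y, 0 ≤ K x y * w x := fun x y => mul_nonneg (hK x y) (hw x).le
  obtain ⟨M, hM, hbound⟩ := exists_uniform_bound (μ₀ := μ₀) (μ₁ := μ₁) hw hrev hpm (C / a ^ 2)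
  obtain ⟨m, hm, hmp⟩ := exists_pos_le hp
  have hc : 0 < m / M := by positivity
  have hcM : ∀ x, m / M * M ≤ p x := fun x => by rw [div_mul_cancel₀ _ hM.ne']; exact hmp x
  -- the data of a curve of action at most `C`
  have hdata : ∀ μ ψ h, IsIntegralCE K p μ₀ μ₁ μ ψ h →
      potentialAction K w a b μ ψ h ≤ ENNReal.ofReal C →
      (∀ t ∈ Icc (0 : ℝ) 1, ∀ x, μ t x ≤ M) ∧
      b ^ 2 * ∫ t in (0 : ℝ)..1, normSq K w (μ t) (grad (ψ t)) ≤ C := by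
    intro μ ψ h hCE hle
    obtain ⟨hh, hh2, hE, heq⟩ := hCE.of_action_ne_top hKw ha hb
      (hle.trans_lt ENNReal.ofReal_lt_top).ne
    rw [heq, ENNReal.ofReal_le_ofReal_iff hC.le] at hle
    have n1 : 0 ≤ ∫ t in (0 : ℝ)..1, h t ^ 2 :=
      intervalIntegral.integral_nonneg zero_le_one fun t _ => sq_nonneg _
    have n2 : 0 ≤ ∫ t in (0 : ℝ)..1, normSq K w (μ t) (grad (ψ t)) :=
      intervalIntegral.integral_nonneg zero_le_one fun t _ => hCE.normSq_nonneg hKw t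
    have m1 := mul_nonneg (sq_nonneg a) n1
    have m2 := mul_nonneg (sq_nonneg b) n2
    refine ⟨hbound μ ψ h hCE hh hh2 ?_, by linarith⟩
    rw [le_div_iff₀ (by positivity)]
    linarith
  constructor
  · intro μ' ψ h hCE' hle
    obtain ⟨μ, hCE, hact⟩ := hCE'.exists_isIntegralCE w a b
    rw [← hact] at hle ⊢
    obtain ⟨hh, hh2, hE, heq⟩ := hCE.of_action_ne_top hKw ha hb
      (hle.trans_lt ENNReal.ofReal_lt_top).ne
    obtain ⟨hμM, -⟩ := hdata μ ψ h hCE hle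
    obtain ⟨R₀, hR₀, -, hRQ⟩ := exists_max_primitive hh hh2
    have hlim := le_of_forall_excess (a := a) (b := b) (η := 0) hc (hCE.normSq_nonneg hKw) hh hE hR₀
      (fun ε hε => hCE.distD_sq_le hw hK hrev hpm hμ₀ hμ₁ hM hμM hc hcM hh hE hR₀ hε)
      le_rfl zero_le_one le_rfl le_rfl fun t ht _ => sub_nonneg.2 (hR₀ t ht)
    rw [heq]
    refine hlim.trans (ENNReal.ofReal_le_ofReal ?_)
    rw [sub_self, zero_div, zero_add]
    gcongr
  · intro hspan
    obtain ⟨κ, hκ, hlower⟩ := exists_lower_bound_integral_sqrt hw hK hrev hp hspan M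
    obtain ⟨δ, hδ, hgap⟩ := exists_gap_of_forall_excess ha hb hc hκ hC
    refine ⟨δ, hδ, fun μ' ψ h hCE' hle => ?_⟩
    obtain ⟨μ, hCE, hact⟩ := hCE'.exists_isIntegralCE w a b
    rw [← hact] at hle ⊢
    obtain ⟨hh, hh2, hE, heq⟩ := hCE.of_action_ne_top hKw ha hb
      (hle.trans_lt ENNReal.ofReal_lt_top).ne
    obtain ⟨hμM, hEC⟩ := hdata μ ψ h hCE hle
    obtain ⟨R₀, hR₀, hattain, hRQ⟩ := exists_max_primitive hh hh2
    rw [heq]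
    exact hgap _ _ h R₀ (ENNReal.pow_ne_top hD.ne) (hCE.normSq_nonneg hKw) hh hh2 hE
      (hCE.intervalIntegrable_sqrt_normSq hKw hE) hR₀ hattain hRQ
      (fun ε hε => hCE.distD_sq_le hw hK hrev hpm hμ₀ hμ₁ hM hμM hc hcM hh hE hR₀ hε)
      (hlower μ ψ h hCE hμM hE) hEC

end UniformBounds

end ShiftTransport

theorem mainTheorem5 {X : Type*} [Fintype X]
    (K : Matrix X X ℝ) (hK_irr : K.IsIrreducible) (hK_sum : ∀ x, ∑ y, K x y = 1)
    (w : X → ℝ) (hw_nonneg : ∀ x, 0 ≤ w x) (hw_sum : ∑ x, w x = 1)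
    (hw_inv : ∀ x, w x = ∑ y, w y * K y x)
    (hw_rev : ∀ x y, K x y * w x = K y x * w y)
    (a b : ℝ) (ha : 0 < a) (hb : 0 < b)
    (p : X → ℝ) (hp_pos : ∀ x, 0 < p x) (hp_mass : ShiftTransport.mass w p = 1)
    (μ₀ μ₁ : X → ℝ) (hμ₀ : ∀ x, 0 ≤ μ₀ x) (hμ₁ : ∀ x, 0 ≤ μ₁ x) :
    ShiftTransport.distD K w p a b μ₀ μ₁ ≤ ShiftTransport.distW K w p a b μ₀ μ₁ ∧
    (μ₀ - μ₁ ∉ Submodule.span ℝ {p} →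
      ShiftTransport.distD K w p a b μ₀ μ₁ < ShiftTransport.distW K w p a b μ₀ μ₁) := by
  have hw := ShiftTransport.weight_pos hK_irr hw_nonneg hw_sum hw_rev
  have hpm := hp_mass
  rw [ShiftTransport.mass_of_nonneg fun x => (hp_pos x).le] at hpm
  have hD := ShiftTransport.distD_lt_top hK_irr hw hw_rev hp_pos hp_mass hμ₀ hμ₁ a b
  have hmain {C : ℝ} (hC : 0 < C) := ShiftTransport.distD_sq_le_potentialAction (C := C)
    hw hK_irr.nonneg hw_rev ha hb hp_pos hpm hμ₀ hμ₁ hD hC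
  set D := ShiftTransport.distD K w p a b μ₀ μ₁
  have hsqrt : D = (D ^ 2) ^ (1 / 2 : ℝ) := by
    rw [← ENNReal.rpow_natCast, ← ENNReal.rpow_mul]
    norm_num
  unfold ShiftTransport.distW
  set W := ⨅ (μ : ℝ → X → ℝ) (ψ : ℝ → X → ℝ) (h : ℝ → ℝ)
    (_ : ShiftTransport.IsCE K p μ₀ μ₁ μ ψ h), ShiftTransport.potentialAction K w a b μ ψ h
    with hW
  have hle : D ^ 2 ≤ W := by
    refine le_iInf fun μ => le_iInf fun ψ => le_iInf fun h => le_iInf fun hCE => ?_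
    by_cases htop : ShiftTransport.potentialAction K w a b μ ψ h = ∞
    · simp [htop]
    · refine (hmain (C := (ShiftTransport.potentialAction K w a b μ ψ h).toReal + 1)
        (by positivity)).1 μ ψ h hCE ?_
      refine ENNReal.le_ofReal_iff_toReal_le htop (by positivity) |>.2 ?_
      linarith
  refine ⟨?_, fun hspan => ?_⟩
  · rw [hsqrt]
    gcongr
  · rw [hsqrt]
    refine ENNReal.rpow_lt_rpow ?_ (by norm_num)
    by_cases hWtop : W = ∞
    · rw [hWtop]
      exact ENNReal.pow_lt_top hD
    -- only curves of action at most `W + 1` matter for the infimum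
    obtain ⟨δ, hδ, hgap⟩ := (hmain (C := W.toReal + 1) (by positivity)).2 hspan
    have hWC : ENNReal.ofReal (W.toReal + 1) = W + 1 := by
      rw [ENNReal.ofReal_add ENNReal.toReal_nonneg zero_le_one, ENNReal.ofReal_toReal hWtop,
        ENNReal.ofReal_one]
    have hgapW : D ^ 2 + min (ENNReal.ofReal δ) 1 ≤ W := by
      refine le_iInf fun μ => le_iInf fun ψ => le_iInf fun h => le_iInf fun hCE => ?_
      rcases le_total (ShiftTransport.potentialAction K w a b μ ψ h)
        (ENNReal.ofReal (W.toReal + 1)) with hA | hA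
      · exact (add_le_add_right (min_le_left _ _) _).trans (hgap μ ψ h hCE hA)
      · exact (add_le_add hle (min_le_right _ _)).trans (hWC ▸ hA)
    refine (ENNReal.lt_add_right (ENNReal.pow_ne_top hD.ne) ?_).trans_le hgapW
    exact (lt_min (ENNReal.ofReal_pos.2 hδ) one_pos).ne'
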